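/- **Theorem 4.1 (supercloseness of average-type curl recovery).** Let $d\in\{2,3\}$, let $\Omega\subset\mathbb R^d$ be a bounded simply connected Lipschitz domain, and let $\sigma>0$. There is a constant $C>0$, depending only on $\Omega$ and $\sigma$, with the following property. Let $\mathcal T_h$ be a conforming triangulation of $\overline\Omega$ into finitely many closed simplices (triangles for $d=2$, tetrahedra for $d=3$), with mesh size $h=\max_{K\in\mathcal T_h}\operatorname{diam}K$, that is shape regular and quasi-uniform with constant $\sigma$: every $K\in\mathcal T_h$ contains a ball of some radius $r>0$ with $\operatorname{diam}K\le\sigma r$, and $h\le\sigma\operatorname{diam}K$. Let $f\in L^2(\Omega)^d$ and let $Tf\in H_0(\mathrm{curl},\Omega)$, together with some $Sf\in H^1_0(\Omega)$, solve $$(\mathrm{curl}\,Tf,\mathrm{curl}\,v)+(\nabla Sf,v)=(f,v)\quad\forall v\in H_0(\mathrm{curl},\Omega),\qquad (\nabla q,Tf)=0\quad\forall q\in H^1_0(\Omega),$$ where $(\cdot,\cdot)$ is the $L^2(\Omega)$ inner product, $\mathrm{curl}\,v=\partial_1v_2-\partial_2v_1$ if $d=2$, $\mathrm{curl}\,v$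 is the usual vector curl if $d=3$, and $H_0(\mathrm{curl},\Omega)$ is the space of $v\in L^2(\Omega)^d$ with $\mathrm{curl}\,v\in L^2(\Omega)$ and $v\times n=0$ on $\partial\Omega$. Suppose that $Tf\in PW^{3,\infty}(\Omega)$, that is, $Tf\in L^\infty(\Omega)^d$ and $Tf|_K\in W^{3,\infty}(K)^d$ for all $K\in\mathcal T_h$, and put $\|Tf\|_{PW^{3,\infty}(\Omega)}=\max_{K\in\mathcal T_h}\|Tf\|_{W^{3,\infty}(K)}$. Then $\mathrm{curl}(Tf|_K)$ is continuous on the closed simplex $K$ for every $K\in\mathcal T_h$, so that the recovered curl $C_hTf$ is defined: it is the continuous function on $\overline\Omega$, affine on each $K\in\mathcal T_h$ (scalar if $d=2$, with values in $\mathbb R^3$ if $d=3$), with $$C_hTf(z)=\frac1{m_z}\sum_{K\in\mathcal T_h,\;z\in K}\bigl(\mathrm{curl}(Tf|_K)\bigr)(z)$$ at every vertex $z$ of $\mathcal T_h$, where $m_z$ is the number of elements having $z$ as a vertex. Moreover $$\|\mathrm{curl}\,Tf-C_hTf\|_{L^2(\Omega)}\le C\,h^2\,\|Tf\|_{PW^{3,\infty}(\Omega)}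 .$$ -/

import Mathlib

open MeasureTheory Set Filter Topology
open scoped ContDiff ENNReal NNReal

namespace CurlRecovery

noncomputable section

/-- Euclidean space of dimension `d`. -/
abbrev Vec (d : ℕ) : Type := EuclideanSpace ℝ (Fin d)

/-- The `i`-th coordinate vector. -/
def basisVec {d : ℕ} (i : Fin d) : Vec d := EuclideanSpace.single i (1 : ℝ)

/-- The number of components of the curl of a `d`-dimensional field: a scalar for `d = 2`,
a vector for `d = 3`. Other dimensions are not used. -/
def curlDim : ℕ → ℕ
  | 2 => 1
  | 3 => 3
  | _ => 0

/-- The pair `(a, b)` for which the `k`-th component of `curl v` is `∂_a v_b - ∂_b v_a`: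
`curl v = ∂₀ v₁ - ∂₁ v₀` for `d = 2`, and
`curl v = (∂₁ v₂ - ∂₂ v₁, ∂₂ v₀ - ∂₀ v₂, ∂₀ v₁ - ∂₁ v₀)` for `d = 3`. -/
def curlPair : (d : ℕ) → Fin (curlDim d) → Fin d × Fin d
  | 0, k => Fin.elim0 k
  | 1, k => Fin.elim0 k
  | 2, _ => ((0 : Fin 2), (1 : Fin 2))
  | 3, k => ![((1 : Fin 3), (2 : Fin 3)), ((2 : Fin 3), (0 : Fin 3)), ((0 : Fin 3), (1 : Fin 3))] k
  | _ + 4, k => Fin.elim0 k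

/-! ### Domains -/

/-- A bounded Lipschitz domain: a bounded, connected open set which, near every boundary point
and in suitable orthogonal coordinates, is the region above the graph of a Lipschitz function.
Here `ν` is the vertical direction, and `γ`, being constant along `ν`, is a function of the
horizontal variables only. -/
structure IsLipschitzDomain {d : ℕ} (Ω : Set (Vec d)) : Prop where
  isOpen : IsOpen Ω
  isConnected : IsConnected Ω
  isBounded : Bornology.IsBounded Ω
  graph : ∀ p ∈ frontier Ω, ∃ (ν : Vec d) (γ : Vec d → ℝ) (L : ℝ≥0) (U : Set (Vec d)),
    ‖ν‖ = 1 ∧ LipschitzWith L γ ∧ (∀ x (t : ℝ), γ (x + t • ν) = γ x) ∧ IsOpen U ∧ p ∈ U ∧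
      ∀ x ∈ U, x ∈ Ω ↔ γ x < inner ℝ ν x

/-! ### Weak derivatives and function spaces -/

/-- `φ ∈ C_c^∞(D)`. -/
structure IsTest {d : ℕ} (D : Set (Vec d)) (φ : Vec d → ℝ) : Prop where
  smooth : ContDiff ℝ ∞ φ
  compact : HasCompactSupport φ
  support : tsupport φ ⊆ D

/-- Integration by parts `∫_D (curl v)_k φ = ∫_D (v_a ∂_b φ - v_b ∂_a φ)` against the single
function `φ`, for all components `k`, with `g` in the role of `curl v`. -/
def CurlByParts {d : ℕ} (D : Set (Vec d)) (v : Vec d → Vec d) (g : Vec d → Vec (curlDim d))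
    (φ : Vec d → ℝ) : Prop :=
  ∀ k : Fin (curlDim d),
    ∫ x in D, g x k * φ x =
      ∫ x in D, (v x (curlPair d k).1 * fderiv ℝ φ x (basisVec (curlPair d k).2)
        - v x (curlPair d k).2 * fderiv ℝ φ x (basisVec (curlPair d k).1))

/-- `g` is the weak curl of `v` on the open set `D`. -/
structure IsWeakCurl {d : ℕ} (D : Set (Vec d)) (v : Vec d → Vec d)
    (g : Vec d → Vec (curlDim d)) : Prop where
  locInt : LocallyIntegrableOn v D
  locInt_curl : LocallyIntegrableOn g D
  byParts : ∀ φ, IsTest D φ → CurlByParts D v g φ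

/-- `v ∈ H₀(curl, Ω)` and `curl v = g`. The tangential trace `v × n` on `∂Ω` is the boundary term
of Green's formula, so it vanishes when the integration by parts holds without boundary term also
for smooth functions `φ` that do not vanish on `∂Ω`. -/
structure IsHZeroCurl {d : ℕ} (Ω : Set (Vec d)) (v : Vec d → Vec d)
    (g : Vec d → Vec (curlDim d)) : Prop where
  memLp : MemLp v 2 (volume.restrict Ω)
  memLp_curl : MemLp g 2 (volume.restrict Ω)
  byParts : ∀ φ, IsTest univ φ → CurlByParts Ω v g φ

/-- `q ∈ H¹₀(Ω)`, the closure of `C_c^∞(Ω)` in `H¹(Ω)`, and `∇q = g`. -/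
structure IsHOneZero {d : ℕ} (Ω : Set (Vec d)) (q : Vec d → ℝ) (g : Vec d → Vec d) : Prop where
  memLp : MemLp q 2 (volume.restrict Ω)
  memLp_grad : MemLp g 2 (volume.restrict Ω)
  approx : ∃ φ : ℕ → Vec d → ℝ, (∀ n, IsTest Ω (φ n)) ∧
    Tendsto (fun n => eLpNorm (fun x => φ n x - q x) 2 (volume.restrict Ω)) atTop (𝓝 0) ∧
    Tendsto (fun n => eLpNorm (fun x => gradient (φ n) x - g x) 2 (volume.restrict Ω)) atTop (𝓝 0)

/-- `g` is the weak derivative `∂_{I 0} ⋯ ∂_{I (k-1)} v` on the open set `D`. -/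
structure IsWeakDeriv {d : ℕ} (D : Set (Vec d)) {k : ℕ} (I : Fin k → Fin d)
    (v g : Vec d → Vec d) : Prop where
  locInt : LocallyIntegrableOn v D
  locInt_deriv : LocallyIntegrableOn g D
  byParts : ∀ φ, IsTest D φ →
    ∫ x in D, φ x • g x =
      (-1 : ℝ) ^ k • ∫ x in D, iteratedFDeriv ℝ k φ x (fun j => basisVec (I j)) • v x

open Classical in
/-- The weak derivative `∂_{I 0} ⋯ ∂_{I (k-1)} v` on `D` (unique almost everywhere on `D`);
zero if there is none. -/
def weakDeriv {d : ℕ} (D : Set (Vec d)) {k : ℕ} (I : Fin k → Fin d) (v : Vec d → Vec d) :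
    Vec d → Vec d :=
  if h : ∃ g, IsWeakDeriv D I v g then h.choose else 0

/-- `v ∈ W^{n,∞}(D)`. -/
def MemWInfty {d : ℕ} (n : ℕ) (D : Set (Vec d)) (v : Vec d → Vec d) : Prop :=
  ∀ k ≤ n, ∀ I : Fin k → Fin d, ∃ g, IsWeakDeriv D I v g ∧ MemLp g ∞ (volume.restrict D)

/-- The norm of `W^{n,∞}(D)`: the largest `L^∞` norm of a weak derivative of order at most `n`. -/
def wInftyNorm {d : ℕ} (n : ℕ) (D : Set (Vec d)) (v : Vec d → Vec d) : ℝ≥0∞ :=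
  ⨆ (k : ℕ) (_ : k ≤ n) (I : Fin k → Fin d), eLpNorm (weakDeriv D I v) ∞ (volume.restrict D)

/-! ### The source problem -/

/-- The pair `(u, s)`, with `u ∈ H₀(curl, Ω)`, `c = curl u`, `s ∈ H¹₀(Ω)`, `gs = ∇s`, solves
`(curl u, curl v) + (∇s, v) = (f, v)` for all `v ∈ H₀(curl, Ω)` and
`(∇q, u) = 0` for all `q ∈ H¹₀(Ω)`; that is, `u = T f` and `s = S f`. -/
structure IsSourceSolution {d : ℕ} (Ω : Set (Vec d)) (f u : Vec d → Vec d)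
    (c : Vec d → Vec (curlDim d)) (s : Vec d → ℝ) (gs : Vec d → Vec d) : Prop where
  mem_u : IsHZeroCurl Ω u c
  mem_s : IsHOneZero Ω s gs
  eq_curl : ∀ v cv, IsHZeroCurl Ω v cv →
    (∫ x in Ω, inner ℝ (c x) (cv x)) + ∫ x in Ω, inner ℝ (gs x) (v x) =
      ∫ x in Ω, inner ℝ (f x) (v x)
  eq_div : ∀ q gq, IsHOneZero Ω q gq → ∫ x in Ω, inner ℝ (gq x) (u x) = 0

/-! ### Meshes -/

/-- A mesh; conformity is part of the notion of a simplicial complex. -/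
abbrev Mesh (d : ℕ) : Type := Geometry.SimplicialComplex ℝ (Vec d)

/-- The elements of a mesh: its simplices of full dimension, given by their vertices. -/
def elements {d : ℕ} (T : Mesh d) : Set (Finset (Vec d)) := {K | K ∈ T.faces ∧ K.card = d + 1}

/-- The closed simplex with vertex set `K`. -/
abbrev body {d : ℕ} (K : Finset (Vec d)) : Set (Vec d) := convexHull ℝ (K : Set (Vec d))

/-- The mesh size: the largest diameter of an element. -/
def meshSize {d : ℕ} (T : Mesh d) : ℝ := sSup ((fun K => Metric.diam (body K)) '' elements T)

/-- `T` is a finite partition of `Ω` into triangles or tetrahedra. -/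
structure IsTriangulation {d : ℕ} (Ω : Set (Vec d)) (T : Mesh d) : Prop where
  finite : T.faces.Finite
  pure : ∀ s ∈ T.faces, ∃ K ∈ elements T, s ⊆ K
  cover : T.space = closure Ω

/-- Shape regularity and quasi-uniformity of a mesh, with constant `σ`. -/
structure IsQuasiUniform {d : ℕ} (σ : ℝ) (T : Mesh d) : Prop where
  shapeRegular : ∀ K ∈ elements T, ∃ (x : Vec d) (r : ℝ),
    0 < r ∧ Metric.diam (body K) ≤ σ * r ∧ Metric.closedBall x r ⊆ body K
  quasiUniform : ∀ K ∈ elements T, meshSize T ≤ σ * Metric.diam (body K)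

/-- `v ∈ PW^{3,∞}(Ω)`: bounded, and of class `W^{3,∞}` on each element. -/
structure MemPW {d : ℕ} (Ω : Set (Vec d)) (T : Mesh d) (v : Vec d → Vec d) : Prop where
  memLp : MemLp v ∞ (volume.restrict Ω)
  memW : ∀ K ∈ elements T, MemWInfty 3 (interior (body K)) v

/-- The norm of `PW^{3,∞}(Ω)`. -/
def pwNorm {d : ℕ} (T : Mesh d) (v : Vec d → Vec d) : ℝ≥0∞ :=
  ⨆ K ∈ elements T, wInftyNorm 3 (interior (body K)) v

/-! ### The recovery operator -/

/-- `g` is the curl of `v` restricted to the closed element `K`, and is continuous there. -/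
def IsElementCurl {d : ℕ} (K : Finset (Vec d)) (v : Vec d → Vec d)
    (g : Vec d → Vec (curlDim d)) : Prop :=
  ContinuousOn g (body K) ∧ IsWeakCurl (interior (body K)) v g

open Classical in
/-- The continuous function `curl (v|_K)` on the closed element `K` (unique on `K`);
zero if the curl of `v|_K` is not continuous up to the boundary. -/
def elementCurl {d : ℕ} (K : Finset (Vec d)) (v : Vec d → Vec d) : Vec d → Vec (curlDim d) :=
  if h : ∃ g, IsElementCurl K v g then h.choose else 0

/-- `v` belongs to the domain of the recovery operator: `curl (v|_K)` is continuous on `K` for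
every element `K`. (Membership in `H₀(curl, Ω)` is stated separately.) -/
def IsRecoverable {d : ℕ} (T : Mesh d) (v : Vec d → Vec d) : Prop :=
  ∀ K ∈ elements T, ∃ g, IsElementCurl K v g

/-- The elements that have `z` as a vertex. -/
def patch {d : ℕ} (T : Mesh d) (z : Vec d) : Set (Finset (Vec d)) := {K | K ∈ elements T ∧ z ∈ K}

/-- The mean over the elements at `z` of the values at `z` of the elementwise curls of `v`. -/
def nodalAverage {d : ℕ} (T : Mesh d) (v : Vec d → Vec d) (z : Vec d) : Vec (curlDim d) :=
  ((patch T z).ncard : ℝ)⁻¹ • ∑ᶠ K ∈ patch T z, elementCurl K v z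

/-- `w` belongs to the linear Lagrange element space: continuous on the closure of the domain and
affine on each element. -/
def IsLagrange {d m : ℕ} (T : Mesh d) (w : Vec d → Vec m) : Prop :=
  ContinuousOn w T.space ∧
    ∀ K ∈ elements T, ∃ A : Vec d →ᵃ[ℝ] Vec m, ∀ x ∈ body K, w x = A x

/-- `w = C_h v`: the element of the linear Lagrange space (unique on the closure of the domain)
whose value at each node is the average of the elementwise curls. -/
structure IsCurlRecovery {d : ℕ} (T : Mesh d) (v : Vec d → Vec d)
    (w : Vec d → Vec (curlDim d)) : Prop where
  recoverable : IsRecoverable T v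
  lagrange : IsLagrange T w
  nodal : ∀ z ∈ T.vertices, w z = nodalAverage T v z

end

end CurlRecovery

open CurlRecovery

open scoped Manifold

namespace CurlRecovery

noncomputable section

/-! ### Test functions -/

/-- The derivative of `φ` in the direction `v`. -/
def dirDeriv {d : ℕ} (v : Vec d) (φ : Vec d → ℝ) : Vec d → ℝ := fun x => fderiv ℝ φ x v

theorem IsTest.mono {d : ℕ} {D D' : Set (Vec d)} {φ : Vec d → ℝ} (h : IsTest D φ) (hD : D ⊆ D') :
    IsTest D' φ :=
  ⟨h.smooth, h.compact, h.support.trans hD⟩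

theorem IsTest.dirDeriv {d : ℕ} {D : Set (Vec d)} {φ : Vec d → ℝ} (h : IsTest D φ) (v : Vec d) :
    IsTest D (dirDeriv v φ) := by
  refine ⟨?_, ?_, ?_⟩
  · exact (h.smooth.fderiv_right (m := ∞) (by simp)).clm_apply contDiff_const
  · exact h.compact.fderiv_apply ℝ v
  · exact (tsupport_fderiv_apply_subset ℝ v).trans h.support

theorem IsTest.mul {d : ℕ} {D : Set (Vec d)} {φ η : Vec d → ℝ} (h : IsTest D φ)
    (hη : ContDiff ℝ ∞ η) : IsTest D (fun x => η x * φ x) :=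
  ⟨hη.mul h.smooth, h.compact.mul_left, tsupport_mul_subset_right.trans h.support⟩

theorem IsTest.sub {d : ℕ} {D : Set (Vec d)} {φ η : Vec d → ℝ} (h : IsTest D φ)
    (hη : IsTest D η) : IsTest D (fun x => φ x - η x) :=
  ⟨h.smooth.sub hη.smooth, h.compact.sub hη.compact,
    (tsupport_sub φ η).trans (union_subset h.support hη.support)⟩

theorem IsTest.continuous {d : ℕ} {D : Set (Vec d)} {φ : Vec d → ℝ} (h : IsTest D φ) :
    Continuous φ := h.smooth.continuous

theorem IsTest.differentiable {d : ℕ} {D : Set (Vec d)} {φ : Vec d → ℝ} (h : IsTest D φ) :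
    Differentiable ℝ φ := h.smooth.differentiable (by simp)

theorem IsTest.integrable {d : ℕ} {D : Set (Vec d)} {φ : Vec d → ℝ} (h : IsTest D φ) :
    Integrable φ := h.continuous.integrable_of_hasCompactSupport h.compact

theorem IsTest.exists_bound {d : ℕ} {D : Set (Vec d)} {φ : Vec d → ℝ} (h : IsTest D φ) :
    ∃ B, 0 ≤ B ∧ ∀ x, |φ x| ≤ B := by
  obtain ⟨B, hB⟩ := h.compact.exists_bound_of_continuous h.continuous
  exact ⟨B, (norm_nonneg _).trans (hB 0), hB⟩

theorem IsTest.memLp {d : ℕ} {D : Set (Vec d)} {φ : Vec d → ℝ} (h : IsTest D φ) (p : ℝ≥0∞) :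
    MemLp φ p := h.continuous.memLp_of_hasCompactSupport h.compact

theorem IsTest.eq_zero {d : ℕ} {D : Set (Vec d)} {φ : Vec d → ℝ} (h : IsTest D φ) {x : Vec d}
    (hx : x ∉ D) : φ x = 0 :=
  image_eq_zero_of_notMem_tsupport fun h' => hx (h.support h')

theorem IsTest.integrable_mul {d : ℕ} {D : Set (Vec d)} {φ g : Vec d → ℝ} (h : IsTest D φ)
    (hg : Integrable g) : Integrable (fun x => g x * φ x) := by
  obtain ⟨B, -, hB⟩ := h.exists_bound
  exact hg.mul_bdd h.continuous.aestronglyMeasurable (Eventually.of_forall hB)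

/-! ### Mollification -/

/-- The convolution of `g` with `θ`. -/
def smear {d : ℕ} (g θ : Vec d → ℝ) (x : Vec d) : ℝ := ∫ y, g y * θ (x - y)

theorem smear_eq_convolution {d : ℕ} (g θ : Vec d → ℝ) :
    smear g θ = convolution g θ (ContinuousLinearMap.mul ℝ ℝ) volume := rfl

theorem contDiff_smear {d : ℕ} {g θ : Vec d → ℝ} (hg : Integrable g) (hθ : IsTest univ θ) :
    ContDiff ℝ ∞ (smear g θ) :=
  hθ.compact.contDiff_convolution_right (ContinuousLinearMap.mul ℝ ℝ) hg.locallyIntegrable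
    (n := ⊤) hθ.smooth

theorem dirDeriv_smear {d : ℕ} {g θ : Vec d → ℝ} (hg : Integrable g) (hθ : IsTest univ θ)
    (v : Vec d) : dirDeriv v (smear g θ) = smear g (dirDeriv v θ) := by
  ext x
  have h1 := hθ.compact.hasFDerivAt_convolution_right (ContinuousLinearMap.mul ℝ ℝ)
    hg.locallyIntegrable (hθ.smooth.of_le (by simp)) x
  rw [dirDeriv, smear_eq_convolution, h1.fderiv, convolution_precompR_apply _ hg.locallyIntegrable
    (hθ.compact.fderiv ℝ) (hθ.smooth.continuous_fderiv (by simp))]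
  rfl

/-- The reflected test function `y ↦ θ (x - y)`. -/
def reflect {d : ℕ} (θ : Vec d → ℝ) (x : Vec d) : Vec d → ℝ := fun y => θ (x - y)

theorem dirDeriv_reflect {d : ℕ} {θ : Vec d → ℝ} (hθ : Differentiable ℝ θ) (x v : Vec d) :
    dirDeriv v (reflect θ x) = fun y => - reflect (dirDeriv v θ) x y := by
  ext y
  have h1 : HasFDerivAt (fun y : Vec d => x - y) (-(ContinuousLinearMap.id ℝ (Vec d))) y := by
    simpa using! (hasFDerivAt_id y).const_sub x
  have h2 := (hθ (x - y)).hasFDerivAt.comp y h1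
  have h3 : fderiv ℝ (reflect θ x) y = _ := h2.fderiv
  rw [dirDeriv, h3]
  simp [reflect, dirDeriv]

theorem smear_eq_integral_reflect {d : ℕ} (g θ : Vec d → ℝ) (x : Vec d) :
    smear g θ x = ∫ y, g y * reflect θ x y := rfl

theorem smear_dirDeriv {d : ℕ} (g : Vec d → ℝ) {θ : Vec d → ℝ} (hθ : Differentiable ℝ θ)
    (x v : Vec d) :
    smear g (dirDeriv v θ) x = - ∫ y, g y * dirDeriv v (reflect θ x) y := by
  rw [dirDeriv_reflect hθ, ← integral_neg]
  simp [smear, reflect]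

theorem smear_dirDeriv_dirDeriv {d : ℕ} (g : Vec d → ℝ) {θ : Vec d → ℝ} (hθ : IsTest univ θ)
    (x v : Vec d) :
    smear g (dirDeriv v (dirDeriv v θ)) x =
      ∫ y, g y * dirDeriv v (dirDeriv v (reflect θ x)) y := by
  rw [smear_dirDeriv g (hθ.dirDeriv v).differentiable, dirDeriv_reflect hθ.differentiable,
    ← integral_neg]
  congr 1
  ext y
  have : dirDeriv v (fun y => - reflect (dirDeriv v θ) x y) y
      = - dirDeriv v (reflect (dirDeriv v θ) x) y := by
    simp only [dirDeriv, fderiv_fun_neg]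
    rfl
  rw [this]
  ring

/-- A bump function supported in the ball of radius `1 / (n + 1)`. -/
def bump (d n : ℕ) : ContDiffBump (0 : Vec d) where
  rIn := 1 / (2 * ((n : ℝ) + 1))
  rOut := 1 / ((n : ℝ) + 1)
  rIn_pos := by positivity
  rIn_lt_rOut := by
    apply one_div_lt_one_div_of_lt <;> linarith [(Nat.cast_nonneg n : (0 : ℝ) ≤ n)]

/-- The standard mollifier. -/
def mollifier (d n : ℕ) : Vec d → ℝ := (bump d n).normed volume

theorem mollifier_nonneg (d n : ℕ) (x : Vec d) : 0 ≤ mollifier d n x := (bump d n).nonneg_normed x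

theorem integral_mollifier (d n : ℕ) : ∫ x, mollifier d n x = 1 := (bump d n).integral_normed

theorem isTest_mollifier (d n : ℕ) : IsTest univ (mollifier d n) :=
  ⟨(bump d n).contDiff_normed, (bump d n).hasCompactSupport_normed, subset_univ _⟩

theorem tsupport_mollifier (d n : ℕ) :
    tsupport (mollifier d n) = Metric.closedBall 0 (1 / ((n : ℝ) + 1)) :=
  (bump d n).tsupport_normed_eq

theorem tendsto_rOut_bump (d : ℕ) : Tendsto (fun n => (bump d n).rOut) atTop (𝓝 0) :=
  tendsto_one_div_add_atTop_nhds_zero_nat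

theorem isTest_reflect {d : ℕ} {θ : Vec d → ℝ} (hθ : IsTest univ θ) {x : Vec d} {r : ℝ}
    (hr : tsupport θ ⊆ Metric.closedBall 0 r) {D : Set (Vec d)} (hD : Metric.closedBall x r ⊆ D) :
    IsTest D (reflect θ x) := by
  have hs : tsupport (reflect θ x) ⊆ Metric.closedBall x r := by
    apply closure_minimal _ Metric.isClosed_closedBall
    intro y hy
    have := hr (subset_tsupport θ (show x - y ∈ Function.support θ from hy))
    simpa [dist_eq_norm, norm_sub_rev] using this
  refine ⟨hθ.smooth.comp (contDiff_const.sub contDiff_id), ?_, hs.trans hD⟩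
  exact HasCompactSupport.of_support_subset_isCompact (isCompact_closedBall x r)
    (subset_closure.trans hs)

theorem integral_reflect {d : ℕ} (θ : Vec d → ℝ) (x : Vec d) : ∫ y, reflect θ x y = ∫ y, θ y :=
  integral_sub_left_eq_self θ volume x

theorem isTest_reflect_mollifier {d n : ℕ} {x : Vec d} {D : Set (Vec d)}
    (hD : Metric.closedBall x (1 / ((n : ℝ) + 1)) ⊆ D) :
    IsTest D (reflect (mollifier d n) x) :=
  isTest_reflect (isTest_mollifier d n) (tsupport_mollifier d n).subset hD

theorem integral_abs_reflect_mollifier (d n : ℕ) (x : Vec d) :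
    ∫ y, |reflect (mollifier d n) x y| = 1 := by
  rw [← integral_mollifier d n, ← integral_reflect (mollifier d n) x]
  exact integral_congr_ae (Eventually.of_forall fun y => abs_of_nonneg (mollifier_nonneg d n _))

theorem smear_mollifier_eq {d : ℕ} (g : Vec d → ℝ) (n : ℕ) (x : Vec d) :
    smear g (mollifier d n) x = convolution ((bump d n).normed volume) g
      (ContinuousLinearMap.lsmul ℝ ℝ) volume x := by
  rw [convolution_eq_swap]
  simp only [smear, mollifier, ContinuousLinearMap.lsmul_apply, smul_eq_mul, mul_comm]

theorem tendsto_smear {d : ℕ} {g : Vec d → ℝ} (hg : AEStronglyMeasurable g volume) {x : Vec d}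
    (hx : ContinuousAt g x) :
    Tendsto (fun n => smear g (mollifier d n) x) atTop (𝓝 (g x)) := by
  simp only [smear_mollifier_eq]
  exact ContDiffBump.convolution_tendsto_right (g := fun _ => g) (k := fun _ => x)
    (tendsto_rOut_bump d) (Eventually.of_forall fun _ => hg)
    (hx.tendsto.comp tendsto_snd) tendsto_const_nhds

theorem ae_tendsto_smear {d : ℕ} {g : Vec d → ℝ} (hg : Integrable g) :
    ∀ᵐ x, Tendsto (fun n => smear g (mollifier d n) x) atTop (𝓝 (g x)) := by
  simp only [smear_mollifier_eq]
  refine ContDiffBump.ae_convolution_tendsto_right_of_locallyIntegrable (K := 2)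
    (tendsto_rOut_bump d) (Eventually.of_forall fun n => ?_) hg.locallyIntegrable
  simp only [bump]
  field_simp
  rfl

theorem eventually_closedBall_subset {d : ℕ} {D S : Set (Vec d)} (hD : IsOpen D) (hS : IsCompact S)
    (hSD : S ⊆ D) :
    ∀ᶠ n : ℕ in atTop, ∀ x ∈ S, Metric.closedBall x (1 / ((n : ℝ) + 1)) ⊆ D := by
  obtain ⟨δ, hδ, h⟩ := hS.exists_cthickening_subset_open hD hSD
  have h1 : ∀ᶠ n : ℕ in atTop, 1 / ((n : ℝ) + 1) < δ :=
    (tendsto_one_div_add_atTop_nhds_zero_nat (𝕜 := ℝ)).eventually_lt_const hδ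
  filter_upwards [h1] with n hn x hx
  exact (Metric.closedBall_subset_closedBall hn.le).trans
    ((Metric.closedBall_subset_cthickening hx δ).trans h)

/-! ### Functions with bounded distributional derivatives -/

/-- The distributional gradient of `g` on `D` is bounded by `M`. -/
def GradBound {d : ℕ} (D : Set (Vec d)) (g : Vec d → ℝ) (M : ℝ) : Prop :=
  ∀ v φ, IsTest D φ → |∫ x, g x * dirDeriv v φ x| ≤ M * ‖v‖ * ∫ x, |φ x|

/-- The second distributional derivatives of `g` along lines in `D` are bounded by `M`. -/
def HessBound {d : ℕ} (D : Set (Vec d)) (g : Vec d → ℝ) (M : ℝ) : Prop :=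
  ∀ v φ, IsTest D φ → |∫ x, g x * dirDeriv v (dirDeriv v φ) x| ≤ M * ‖v‖ ^ 2 * ∫ x, |φ x|

theorem abs_smear_sub_le {d n : ℕ} {D : Set (Vec d)} {g : Vec d → ℝ} {M : ℝ} (hM : 0 ≤ M)
    (hg : Integrable g) (hb : GradBound D g M) {a b : Vec d}
    (hn : ∀ x ∈ segment ℝ a b, Metric.closedBall x (1 / ((n : ℝ) + 1)) ⊆ D) :
    |smear g (mollifier d n) b - smear g (mollifier d n) a| ≤ M * ‖b - a‖ := by
  have hθ := isTest_mollifier d n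
  have hsm := contDiff_smear hg hθ
  refine (convex_segment a b).norm_image_sub_le_of_norm_fderiv_le (𝕜 := ℝ)
    (fun x _ => (hsm.differentiable (by simp)) x) (fun x hx => ?_)
    (left_mem_segment ℝ a b) (right_mem_segment ℝ a b)
  refine ContinuousLinearMap.opNorm_le_bound _ hM fun v => ?_
  have h1 : fderiv ℝ (smear g (mollifier d n)) x v = smear g (dirDeriv v (mollifier d n)) x := by
    rw [← dirDeriv_smear hg hθ]; rfl
  rw [h1, smear_dirDeriv g hθ.differentiable, norm_neg, Real.norm_eq_abs]
  refine (hb v _ (isTest_reflect_mollifier (hn x hx))).trans_eq ?_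
  rw [integral_abs_reflect_mollifier, mul_one]

theorem eventually_abs_smear_sub_le {d : ℕ} {D : Set (Vec d)} (hD : IsOpen D) {g : Vec d → ℝ}
    {M : ℝ} (hM : 0 ≤ M) (hg : Integrable g) (hb : GradBound D g M) {a b : Vec d}
    (hab : segment ℝ a b ⊆ D) :
    ∀ᶠ n in atTop, |smear g (mollifier d n) b - smear g (mollifier d n) a| ≤ M * ‖b - a‖ := by
  have hc : IsCompact (segment ℝ a b) := by
    rw [segment_eq_image_lineMap]
    exact isCompact_Icc.image (AffineMap.lineMap_continuous (p := a) (q := b))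
  filter_upwards [eventually_closedBall_subset hD hc hab] with n hn
  exact abs_smear_sub_le hM hg hb hn

/-- A function with bounded distributional gradient on a convex open set has a Lipschitz
representative. -/
theorem exists_lipschitz_representative {d : ℕ} {D : Set (Vec d)} (hD : IsOpen D)
    (hconv : Convex ℝ D) {g : Vec d → ℝ} {M : ℝ≥0} (hg : Integrable g) (hb : GradBound D g M) :
    ∃ g' : Vec d → ℝ, LipschitzWith M g' ∧ ∀ᵐ x, x ∈ D → g' x = g x := by
  set S : Set (Vec d) :=
    {x | x ∈ D ∧ Tendsto (fun n => smear g (mollifier d n) x) atTop (𝓝 (g x))} with hS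
  have hlip : LipschitzOnWith M g S := by
    refine LipschitzOnWith.of_dist_le_mul fun x hx y hy => ?_
    have h1 := eventually_abs_smear_sub_le hD M.2 hg hb (hconv.segment_subset hy.1 hx.1)
    have h2 := ((hx.2.sub hy.2).abs)
    rw [Real.dist_eq, dist_eq_norm]
    exact le_of_tendsto h2 h1
  obtain ⟨g', hg', heq⟩ := hlip.extend_real
  refine ⟨g', hg', ?_⟩
  filter_upwards [ae_tendsto_smear hg] with x hx hxD
  exact (heq ⟨hxD, hx⟩).symm

theorem smear_add_sq_le {d n : ℕ} {D : Set (Vec d)} {g : Vec d → ℝ} {M : ℝ}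
    (hg : Integrable g) (hb : HessBound D g M) {a b : Vec d}
    (hn : ∀ x ∈ segment ℝ a b, Metric.closedBall x (1 / ((n : ℝ) + 1)) ⊆ D) {s t : ℝ}
    (hs : 0 ≤ s) (ht : 0 ≤ t) (hst : s + t = 1) :
    smear g (mollifier d n) (s • a + t • b) + M / 2 * ‖s • a + t • b‖ ^ 2 ≤
      s * (smear g (mollifier d n) a + M / 2 * ‖a‖ ^ 2) +
        t * (smear g (mollifier d n) b + M / 2 * ‖b‖ ^ 2) := by
  have hθ := isTest_mollifier d n
  set v := b - a with hv
  have hline : ∀ r : ℝ, HasDerivAt (fun r : ℝ => a + r • v) v r := fun r => by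
    simpa using ((hasDerivAt_id r).smul_const v).const_add a
  have hder : ∀ (θ : Vec d → ℝ), IsTest univ θ → ∀ r : ℝ,
      HasDerivAt (fun r : ℝ => smear g θ (a + r • v)) (smear g (dirDeriv v θ) (a + r • v)) r := by
    intro θ hθ r
    have h1 := (((contDiff_smear hg hθ).differentiable (by simp)) (a + r • v)).hasFDerivAt
    have h2 := h1.comp_hasDerivAt r (hline r)
    rw [← dirDeriv_smear hg hθ]
    exact h2
  have hsq : ∀ r : ℝ, HasDerivAt (fun r : ℝ => M / 2 * ‖a + r • v‖ ^ 2)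
      (M * inner ℝ (a + r • v) v) r := fun r => by
    have := ((hline r).norm_sq).const_mul (M / 2)
    exact this.congr_deriv (by ring)
  have hin : ∀ r : ℝ, HasDerivAt (fun r : ℝ => M * inner ℝ (a + r • v) v) (M * ‖v‖ ^ 2) r :=
    fun r => by
    have := ((hline r).inner ℝ (hasDerivAt_const r v)).const_mul M
    simpa using this
  have hconv : ConvexOn ℝ (Icc (0 : ℝ) 1)
      (fun r : ℝ => smear g (mollifier d n) (a + r • v) + M / 2 * ‖a + r • v‖ ^ 2) := by
    refine convexOn_of_hasDerivWithinAt2_nonneg (convex_Icc 0 1)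
      (fun r _ => ((hder _ hθ r).add (hsq r)).continuousAt.continuousWithinAt)
      (fun r _ => ((hder _ hθ r).add (hsq r)).hasDerivWithinAt)
      (fun r _ => ((hder _ (hθ.dirDeriv v) r).add (hin r)).hasDerivWithinAt) (fun r hr => ?_)
    rw [interior_Icc] at hr
    have hmem : a + r • v ∈ segment ℝ a b := by
      rw [segment_eq_image']
      exact ⟨r, ⟨hr.1.le, hr.2.le⟩, rfl⟩
    have h1 := hb v _ (isTest_reflect_mollifier (hn _ hmem))
    rw [integral_abs_reflect_mollifier, mul_one, ← smear_dirDeriv_dirDeriv g hθ] at h1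
    linarith [(abs_le.1 h1).1]
  have h0 := hconv.2 (left_mem_Icc.2 zero_le_one) (right_mem_Icc.2 zero_le_one) hs ht hst
  have e1 : a + t • v = s • a + t • b := by
    rw [hv, ← eq_sub_iff_add_eq.2 hst |>.symm]
    module
  have e2 : a + v = b := by rw [hv]; abel
  simpa [e1, e2] using h0

/-- A continuous function with second distributional derivatives bounded by `M` becomes convex
when `M / 2 * ‖x‖ ^ 2` is added. -/
theorem convexOn_add_sq {d : ℕ} {D : Set (Vec d)} (hD : IsOpen D) (hconv : Convex ℝ D)
    {g : Vec d → ℝ} {M : ℝ} (hg : Integrable g) (hc : ContinuousOn g D) (hb : HessBound D g M) :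
    ConvexOn ℝ D (fun x => g x + M / 2 * ‖x‖ ^ 2) := by
  refine ⟨hconv, fun a ha b hb' s t hs ht hst => ?_⟩
  have hab := hconv.segment_subset ha hb'
  have hcomp : IsCompact (segment ℝ a b) := by
    rw [segment_eq_image_lineMap]
    exact isCompact_Icc.image (AffineMap.lineMap_continuous (p := a) (q := b))
  have key : ∀ x ∈ D, Tendsto (fun n => smear g (mollifier d n) x + M / 2 * ‖x‖ ^ 2) atTop
      (𝓝 (g x + M / 2 * ‖x‖ ^ 2)) := fun x hx =>
    (tendsto_smear hg.aestronglyMeasurable (hc.continuousAt (hD.mem_nhds hx))).add_const _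
  refine le_of_tendsto_of_tendsto (key _ (hconv ha hb' hs ht hst))
    (((key a ha).const_mul s).add ((key b hb').const_mul t)) ?_
  filter_upwards [eventually_closedBall_subset hD hcomp hab] with n hn
  exact smear_add_sq_le hg hb hn hs ht hst

theorem HessBound.neg {d : ℕ} {D : Set (Vec d)} {g : Vec d → ℝ} {M : ℝ} (h : HessBound D g M) :
    HessBound D (fun x => - g x) M := by
  intro v φ hφ
  simpa [integral_neg] using h v φ hφ

/-! ### Weak derivatives -/

theorem IsTest.integrable_smul {d : ℕ} {F : Type*} [NormedAddCommGroup F] [NormedSpace ℝ F]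
    {D : Set (Vec d)} {φ : Vec d → ℝ} (h : IsTest D φ) {f : Vec d → F}
    (hf : LocallyIntegrableOn f D) : Integrable (fun x => φ x • f x) := by
  have h1 : IntegrableOn f (tsupport φ) := hf.integrableOn_compact_subset h.support h.compact
  obtain ⟨B, -, hB⟩ := h.exists_bound
  have h2 : IntegrableOn (fun x => φ x • f x) (tsupport φ) :=
    Integrable.bdd_smul h1 B h.continuous.aestronglyMeasurable (Eventually.of_forall hB)
  refine (integrableOn_iff_integrable_of_support_subset ?_).1 h2
  exact (Function.support_smul_subset_left φ f).trans (subset_tsupport φ)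

theorem IsTest.setIntegral_smul {d : ℕ} {F : Type*} [NormedAddCommGroup F] [NormedSpace ℝ F]
    {D : Set (Vec d)} {φ : Vec d → ℝ} (h : IsTest D φ) (f : Vec d → F) :
    ∫ x in D, φ x • f x = ∫ x, φ x • f x :=
  setIntegral_eq_integral_of_forall_compl_eq_zero fun x hx => by simp [h.eq_zero hx]

/-- Locally integrable functions with the same integrals against test functions agree almost
everywhere. -/
theorem ae_eq_of_forall_isTest {d : ℕ} {F : Type*} [NormedAddCommGroup F] [NormedSpace ℝ F]
    [CompleteSpace F] {D : Set (Vec d)} (hD : IsOpen D) {f g : Vec d → F}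
    (hf : LocallyIntegrableOn f D) (hg : LocallyIntegrableOn g D)
    (h : ∀ φ, IsTest D φ → ∫ x in D, φ x • f x = ∫ x in D, φ x • g x) :
    ∀ᵐ x, x ∈ D → f x = g x := by
  have := hD.ae_eq_zero_of_integral_contDiff_smul_eq_zero (f := fun x => f x - g x) (hf.sub hg)
    fun φ h1 h2 h3 => by
      have hφ : IsTest D φ := ⟨h1, h2, h3⟩
      simp only [smul_sub]
      rw [integral_sub (hφ.integrable_smul hf) (hφ.integrable_smul hg), ← hφ.setIntegral_smul,
        ← hφ.setIntegral_smul, h φ hφ, sub_self]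
  filter_upwards [this] with x hx hxD using sub_eq_zero.1 (hx hxD)

theorem IsWeakDeriv.ae_eq {d k : ℕ} {D : Set (Vec d)} (hD : IsOpen D) {I : Fin k → Fin d}
    {v g g' : Vec d → Vec d} (h : IsWeakDeriv D I v g) (h' : IsWeakDeriv D I v g') :
    ∀ᵐ x, x ∈ D → g x = g' x :=
  ae_eq_of_forall_isTest hD h.locInt_deriv h'.locInt_deriv fun φ hφ => by
    rw [h.byParts φ hφ, h'.byParts φ hφ]

theorem isWeakDeriv_weakDeriv {d k : ℕ} {D : Set (Vec d)} {I : Fin k → Fin d}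
    {v : Vec d → Vec d} (h : ∃ g, IsWeakDeriv D I v g) : IsWeakDeriv D I v (weakDeriv D I v) := by
  rw [weakDeriv, dif_pos h]
  exact h.choose_spec

/-- All weak derivatives of `v` on `D` of order at most `n` exist and are bounded by `M`. -/
def WeakDerivBound {d : ℕ} (n : ℕ) (D : Set (Vec d)) (v : Vec d → Vec d) (M : ℝ) : Prop :=
  ∀ k ≤ n, ∀ I : Fin k → Fin d, ∃ g, IsWeakDeriv D I v g ∧ ∀ᵐ x ∂(volume.restrict D), ‖g x‖ ≤ M

theorem eLpNorm_weakDeriv_ne_top {d n k : ℕ} {D : Set (Vec d)} (hD : IsOpen D) {v : Vec d → Vec d}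
    (h : MemWInfty n D v) (hk : k ≤ n) (I : Fin k → Fin d) :
    eLpNorm (weakDeriv D I v) ∞ (volume.restrict D) ≠ ⊤ := by
  obtain ⟨g, hg, hmem⟩ := h k hk I
  have h1 := (isWeakDeriv_weakDeriv ⟨g, hg⟩).ae_eq hD hg
  rw [eLpNorm_congr_ae ((ae_restrict_iff' hD.measurableSet).2 h1)]
  exact hmem.2.ne

theorem wInftyNorm_ne_top {d n : ℕ} {D : Set (Vec d)} (hD : IsOpen D) {v : Vec d → Vec d}
    (h : MemWInfty n D v) : wInftyNorm n D v ≠ ⊤ := by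
  have h1 : wInftyNorm n D v ≤ ⨆ (k : Fin (n + 1)) (I : Fin k → Fin d),
      eLpNorm (weakDeriv D I v) ∞ (volume.restrict D) := by
    refine iSup_le fun k => iSup_le fun hk => ?_
    exact le_iSup (fun k : Fin (n + 1) => ⨆ (I : Fin k → Fin d),
      eLpNorm (weakDeriv D I v) ∞ (volume.restrict D)) ⟨k, Nat.lt_succ_of_le hk⟩
  refine ne_top_of_le_ne_top (iSup_ne_top fun k => iSup_ne_top fun I => ?_) h1
  exact eLpNorm_weakDeriv_ne_top hD h (Nat.le_of_lt_succ k.2) I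

theorem pwNorm_ne_top {d : ℕ} {Ω : Set (Vec d)} {T : Mesh d} (hT : T.faces.Finite)
    {v : Vec d → Vec d} (h : MemPW Ω T v) : pwNorm T v ≠ ⊤ := by
  have hfin : (elements T).Finite := hT.subset fun K hK => hK.1
  have := hfin.to_subtype
  rw [pwNorm, iSup_subtype']
  exact iSup_ne_top fun K => wInftyNorm_ne_top isOpen_interior (h.memW K K.2)

theorem weakDerivBound_pwNorm {d : ℕ} {Ω : Set (Vec d)} {T : Mesh d} (hT : T.faces.Finite)
    {v : Vec d → Vec d} (h : MemPW Ω T v) {K : Finset (Vec d)} (hK : K ∈ elements T) :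
    WeakDerivBound 3 (interior (body K)) v (pwNorm T v).toReal := by
  intro k hk I
  obtain ⟨g, hg, -⟩ := h.memW K hK k hk I
  refine ⟨_, isWeakDeriv_weakDeriv ⟨g, hg⟩, ?_⟩
  have h1 : eLpNorm (weakDeriv (interior (body K)) I v) ∞ (volume.restrict (interior (body K))) ≤
      pwNorm T v := by
    refine le_trans ?_ (le_iSup₂ (f := fun K (_ : K ∈ elements T) =>
      wInftyNorm 3 (interior (body K)) v) K hK)
    refine le_trans ?_ (le_iSup₂ (f := fun (k : ℕ) (_ : k ≤ 3) => ⨆ (I : Fin k → Fin d),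
      eLpNorm (weakDeriv (interior (body K)) I v) ∞ (volume.restrict (interior (body K)))) k hk)
    exact le_iSup (fun I : Fin k → Fin d =>
      eLpNorm (weakDeriv (interior (body K)) I v) ∞ (volume.restrict (interior (body K)))) I
  rw [eLpNorm_exponent_top] at h1
  filter_upwards [ae_le_eLpNormEssSup (f := weakDeriv (interior (body K)) I v)
    (μ := volume.restrict (interior (body K)))] with x hx
  have h2 := ENNReal.toReal_mono (pwNorm_ne_top hT h) (hx.trans h1)
  simpa using h2

theorem iteratedFDeriv_succ_eq_dirDeriv {d k : ℕ} {D : Set (Vec d)} {φ : Vec d → ℝ}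
    (hφ : IsTest D φ) (m : Fin (k + 1) → Vec d) (x : Vec d) :
    iteratedFDeriv ℝ (k + 1) φ x m =
      dirDeriv (m 0) (fun y => iteratedFDeriv ℝ k φ y (Fin.tail m)) x := by
  rw [iteratedFDeriv_succ_apply_left, dirDeriv, fderiv_continuousMultilinear_apply_const_apply]
  exact (hφ.smooth.differentiable_iteratedFDeriv (by exact_mod_cast WithTop.coe_lt_top _)) x

theorem iteratedFDeriv_two_eq_dirDeriv {d : ℕ} {D : Set (Vec d)} {φ : Vec d → ℝ}
    (hφ : IsTest D φ) (a b x : Vec d) :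
    iteratedFDeriv ℝ 2 φ x ![a, b] = dirDeriv a (dirDeriv b φ) x := by
  rw [iteratedFDeriv_succ_eq_dirDeriv hφ]
  congr 1
  ext y
  rw [iteratedFDeriv_succ_eq_dirDeriv hφ]
  simp [Fin.tail]

theorem iteratedFDeriv_three_eq_dirDeriv {d : ℕ} {D : Set (Vec d)} {φ : Vec d → ℝ}
    (hφ : IsTest D φ) (a b c x : Vec d) :
    iteratedFDeriv ℝ 3 φ x ![a, b, c] = dirDeriv a (dirDeriv b (dirDeriv c φ)) x := by
  rw [iteratedFDeriv_succ_eq_dirDeriv hφ]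
  congr 1
  ext y
  rw [← iteratedFDeriv_two_eq_dirDeriv hφ]
  rfl

theorem abs_setIntegral_coord_le {d n k : ℕ} {D : Set (Vec d)}
    {u : Vec d → Vec d} {M : ℝ} (hu : WeakDerivBound n D u M)
    (hk : k ≤ n) (I : Fin k → Fin d) (b : Fin d) {φ ψ : Vec d → ℝ} (hφ : IsTest D φ)
    (hψ : IsTest D ψ)
    (hI : ∀ x, iteratedFDeriv ℝ k φ x (fun j => basisVec (I j)) = ψ x) :
    |∫ x in D, u x b * ψ x| ≤ M * ∫ x, |φ x| := by
  obtain ⟨g, hg, hM⟩ := hu k hk I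
  have h1 : ‖∫ x in D, φ x • g x‖ ≤ ∫ x in D, M * |φ x| := by
    refine norm_integral_le_of_norm_le (hφ.integrable.abs.const_mul M).integrableOn ?_
    filter_upwards [hM] with x hx
    rw [norm_smul, mul_comm, Real.norm_eq_abs]
    gcongr
  have h2 : ∫ x in D, M * |φ x| = M * ∫ x, |φ x| := by
    rw [integral_const_mul, setIntegral_eq_integral_of_forall_compl_eq_zero]
    intro x hx
    simp [hφ.eq_zero hx]
  have h3 : ∫ x in D, u x b * ψ x = (∫ x in D, ψ x • u x) b := by
    have := (EuclideanSpace.proj (𝕜 := ℝ) b : Vec d →L[ℝ] ℝ).integral_comp_comm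
      (hψ.integrable_smul hg.locInt).integrableOn (μ := volume.restrict D)
    simp only [EuclideanSpace.coe_proj] at this
    rw [← this]
    simp [mul_comm]
  have h4 := hg.byParts φ hφ
  simp only [hI] at h4
  rw [h3, ← Real.norm_eq_abs]
  refine (PiLp.norm_apply_le _ b).trans ?_
  have h5 : ‖∫ x in D, φ x • g x‖ = ‖∫ x in D, ψ x • u x‖ := by
    rw [h4, norm_smul, norm_pow]
    simp
  rw [← h5, ← h2]
  exact h1

/-! ### Bounds for weak curls -/

theorem basisVec_sum {d : ℕ} (v : Vec d) : v = ∑ i, v i • basisVec i := by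
  ext j
  simp [basisVec, Pi.single_apply]

theorem dirDeriv_eq_sum {d : ℕ} (v : Vec d) (φ : Vec d → ℝ) (x : Vec d) :
    dirDeriv v φ x = ∑ i, v i * dirDeriv (basisVec i) φ x := by
  conv_lhs => rw [basisVec_sum v]
  simp [dirDeriv]

theorem dirDeriv_sum {d : ℕ} {D : Set (Vec d)} (v w : Vec d) {φ : Vec d → ℝ} (hφ : IsTest D φ)
    (x : Vec d) :
    dirDeriv w (dirDeriv v φ) x = ∑ i, v i * dirDeriv w (dirDeriv (basisVec i) φ) x := by
  have h : dirDeriv v φ = fun x => ∑ i, v i * dirDeriv (basisVec i) φ x :=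
    funext fun x => dirDeriv_eq_sum v φ x
  rw [h]
  have h1 := HasFDerivAt.fun_sum (u := Finset.univ) (x := x) fun (i : Fin d) _ =>
    (((hφ.dirDeriv (basisVec i)).differentiable x).hasFDerivAt.const_mul (v i))
  rw [dirDeriv, h1.fderiv]
  simp [dirDeriv]

theorem gradBound_of_basisVec {d : ℕ} {D : Set (Vec d)} {g : Vec d → ℝ} {M : ℝ}
    (hg : Integrable g)
    (h : ∀ i φ, IsTest D φ → |∫ x, g x * dirDeriv (basisVec i) φ x| ≤ M * ∫ x, |φ x|) :
    GradBound D g (d * M) := by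
  intro v φ hφ
  have h1 : ∫ x, g x * dirDeriv v φ x = ∑ i, v i * ∫ x, g x * dirDeriv (basisVec i) φ x := by
    simp only [← integral_const_mul]
    rw [← integral_finsetSum _ fun i _ => ((hφ.dirDeriv _).integrable_mul hg).const_mul _]
    congr 1
    ext x
    rw [dirDeriv_eq_sum, Finset.mul_sum]
    exact Finset.sum_congr rfl fun i _ => by ring
  rw [h1]
  calc |∑ i, v i * ∫ x, g x * dirDeriv (basisVec i) φ x|
      ≤ ∑ i, |v i * ∫ x, g x * dirDeriv (basisVec i) φ x| := Finset.abs_sum_le_sum_abs _ _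
    _ ≤ ∑ _i : Fin d, ‖v‖ * (M * ∫ x, |φ x|) := by
        refine Finset.sum_le_sum fun i _ => ?_
        rw [abs_mul]
        exact mul_le_mul (PiLp.norm_apply_le v i) (h i φ hφ) (abs_nonneg _) (norm_nonneg _)
    _ = d * M * ‖v‖ * ∫ x, |φ x| := by
        simp
        ring

theorem hessBound_of_basisVec {d : ℕ} {D : Set (Vec d)} {g : Vec d → ℝ} {M : ℝ}
    (hg : Integrable g)
    (h : ∀ i j φ, IsTest D φ →
      |∫ x, g x * dirDeriv (basisVec i) (dirDeriv (basisVec j) φ) x| ≤ M * ∫ x, |φ x|) :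
    HessBound D g (d * (d * M)) := by
  intro v φ hφ
  have h1 : ∫ x, g x * dirDeriv v (dirDeriv v φ) x =
      ∑ i, ∑ j, v i * v j * ∫ x, g x * dirDeriv (basisVec i) (dirDeriv (basisVec j) φ) x := by
    simp only [← integral_const_mul]
    simp only [← Finset.sum_product']
    rw [← integral_finsetSum _ fun i _ =>
      (((hφ.dirDeriv _).dirDeriv _).integrable_mul hg).const_mul _]
    congr 1
    ext x
    rw [dirDeriv_eq_sum, Finset.mul_sum, Finset.sum_product]
    refine Finset.sum_congr rfl fun i _ => ?_
    rw [dirDeriv_sum v _ hφ, Finset.mul_sum, Finset.mul_sum]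
    exact Finset.sum_congr rfl fun j _ => by ring
  rw [h1]
  calc |∑ i, ∑ j, v i * v j * ∫ x, g x * dirDeriv (basisVec i) (dirDeriv (basisVec j) φ) x|
      ≤ ∑ i, ∑ j, |v i * v j *
          ∫ x, g x * dirDeriv (basisVec i) (dirDeriv (basisVec j) φ) x| :=
        (Finset.abs_sum_le_sum_abs _ _).trans
          (Finset.sum_le_sum fun i _ => Finset.abs_sum_le_sum_abs _ _)
    _ ≤ ∑ _i : Fin d, ∑ _j : Fin d, ‖v‖ * ‖v‖ * (M * ∫ x, |φ x|) := by
        refine Finset.sum_le_sum fun i _ => Finset.sum_le_sum fun j _ => ?_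
        rw [abs_mul, abs_mul]
        exact mul_le_mul (mul_le_mul (PiLp.norm_apply_le v i) (PiLp.norm_apply_le v j)
          (abs_nonneg _) (norm_nonneg _)) (h i j φ hφ) (abs_nonneg _)
          (mul_nonneg (norm_nonneg _) (norm_nonneg _))
    _ = d * (d * M) * ‖v‖ ^ 2 * ∫ x, |φ x| := by
        simp
        ring

/-- The `k`-th component of `g`, extended by zero outside `D`. -/
def extComp {d m : ℕ} (D : Set (Vec d)) (g : Vec d → Vec m) (k : Fin m) : Vec d → ℝ :=
  D.indicator fun x => g x k

theorem integrable_extComp {d m : ℕ} {D : Set (Vec d)} (hD : MeasurableSet D) {g : Vec d → Vec m}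
    (hg : IntegrableOn g D) (k : Fin m) : Integrable (extComp D g k) := by
  rw [extComp, integrable_indicator_iff hD]
  exact (EuclideanSpace.proj (𝕜 := ℝ) k : Vec m →L[ℝ] ℝ).integrable_comp hg

theorem integral_extComp_mul {d m : ℕ} {D : Set (Vec d)} (hD : MeasurableSet D)
    (g : Vec d → Vec m) (k : Fin m) (φ : Vec d → ℝ) :
    ∫ x, extComp D g k x * φ x = ∫ x in D, g x k * φ x := by
  rw [← integral_indicator hD]
  congr 1
  ext x
  by_cases hx : x ∈ D <;> simp [extComp, hx]

theorem integrableOn_coord_mul {d m : ℕ} {D : Set (Vec d)} {u : Vec d → Vec m}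
    (hu : LocallyIntegrableOn u D) (b : Fin m) {ψ : Vec d → ℝ} (hψ : IsTest D ψ) :
    IntegrableOn (fun x => u x b * ψ x) D := by
  have := (EuclideanSpace.proj (𝕜 := ℝ) b : Vec m →L[ℝ] ℝ).integrable_comp (hψ.integrable_smul hu)
  refine (this.congr (Eventually.of_forall fun x => ?_)).integrableOn
  simp [mul_comm]

theorem IsWeakCurl.abs_integral_le {d : ℕ} {D : Set (Vec d)} {u : Vec d → Vec d}
    {g : Vec d → Vec (curlDim d)} (h : IsWeakCurl D u g) (k : Fin (curlDim d)) {φ ψ : Vec d → ℝ}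
    (hψ : IsTest D ψ) {A : ℝ}
    (hA : ∀ a b, |∫ x in D, u x b * dirDeriv (basisVec a) ψ x| ≤ A * ∫ x, |φ x|) :
    |∫ x in D, g x k * ψ x| ≤ 2 * A * ∫ x, |φ x| := by
  have h1 := h.byParts ψ hψ k
  have h2 := integral_sub (integrableOn_coord_mul h.locInt (curlPair d k).1
    (hψ.dirDeriv (basisVec (curlPair d k).2))) (integrableOn_coord_mul h.locInt (curlPair d k).2
    (hψ.dirDeriv (basisVec (curlPair d k).1)))
  rw [h1]
  have h3 := abs_sub (∫ x in D, u x (curlPair d k).1 * dirDeriv (basisVec (curlPair d k).2) ψ x)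
    (∫ x in D, u x (curlPair d k).2 * dirDeriv (basisVec (curlPair d k).1) ψ x)
  rw [← h2] at h3
  refine le_trans h3 ?_
  linarith [hA (curlPair d k).2 (curlPair d k).1, hA (curlPair d k).1 (curlPair d k).2]

theorem IsWeakCurl.abs_integral_dirDeriv_le {d : ℕ} {D : Set (Vec d)} (hD : MeasurableSet D)
    {u : Vec d → Vec d} {M : ℝ} (hu : WeakDerivBound 3 D u M) {g : Vec d → Vec (curlDim d)}
    (h : IsWeakCurl D u g) (k : Fin (curlDim d)) (i : Fin d) {φ : Vec d → ℝ} (hφ : IsTest D φ) :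
    |∫ x, extComp D g k x * dirDeriv (basisVec i) φ x| ≤ 2 * M * ∫ x, |φ x| := by
  rw [integral_extComp_mul hD]
  refine h.abs_integral_le k (hφ.dirDeriv _) fun a b => ?_
  refine abs_setIntegral_coord_le hu (by norm_num) ![a, i] b hφ ((hφ.dirDeriv _).dirDeriv _) ?_
  intro x
  rw [← iteratedFDeriv_two_eq_dirDeriv hφ]
  congr 1
  ext j
  fin_cases j <;> rfl

theorem IsWeakCurl.gradBound {d : ℕ} {D : Set (Vec d)} (hD : MeasurableSet D)
    {u : Vec d → Vec d} {M : ℝ} (hu : WeakDerivBound 3 D u M) {g : Vec d → Vec (curlDim d)}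
    (h : IsWeakCurl D u g) (hg : IntegrableOn g D) (k : Fin (curlDim d)) :
    GradBound D (extComp D g k) (d * (2 * M)) :=
  gradBound_of_basisVec (integrable_extComp hD hg k) fun i _ hφ =>
    h.abs_integral_dirDeriv_le hD hu k i hφ

theorem IsWeakCurl.hessBound {d : ℕ} {D : Set (Vec d)} (hD : MeasurableSet D)
    {u : Vec d → Vec d} {M : ℝ} (hu : WeakDerivBound 3 D u M) {g : Vec d → Vec (curlDim d)}
    (h : IsWeakCurl D u g) (hg : IntegrableOn g D) (k : Fin (curlDim d)) :
    HessBound D (extComp D g k) (d * (d * (2 * M))) := by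
  refine hessBound_of_basisVec (integrable_extComp hD hg k) fun i j φ hφ => ?_
  rw [integral_extComp_mul hD]
  refine h.abs_integral_le k ((hφ.dirDeriv _).dirDeriv _) fun a b => ?_
  refine abs_setIntegral_coord_le hu (by norm_num) ![a, i, j] b hφ
    (((hφ.dirDeriv _).dirDeriv _).dirDeriv _) ?_
  intro x
  rw [← iteratedFDeriv_three_eq_dirDeriv hφ]
  congr 1
  ext l
  fin_cases l <;> rfl

theorem IsWeakCurl.ae_eq {d : ℕ} {D : Set (Vec d)} (hD : IsOpen D) {u : Vec d → Vec d}
    {g g' : Vec d → Vec (curlDim d)} (h : IsWeakCurl D u g) (h' : IsWeakCurl D u g') :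
    ∀ᵐ x, x ∈ D → g x = g' x := by
  have hloc : ∀ {f : Vec d → Vec (curlDim d)}, LocallyIntegrableOn f D → ∀ k,
      LocallyIntegrableOn (fun x => f x k) D := fun hf k x hx => by
    obtain ⟨s, hs, hint⟩ := hf x hx
    exact ⟨s, hs, (EuclideanSpace.proj (𝕜 := ℝ) k : Vec (curlDim d) →L[ℝ] ℝ).integrable_comp hint⟩
  have key : ∀ k, ∀ᵐ x, x ∈ D → g x k = g' x k := fun k => by
    refine ae_eq_of_forall_isTest hD (hloc h.locInt_curl k) (hloc h'.locInt_curl k) fun φ hφ => ?_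
    simp only [smul_eq_mul, mul_comm (φ _)]
    rw [h.byParts φ hφ k, h'.byParts φ hφ k]
  filter_upwards [ae_all_iff.2 key] with x hx hxD
  ext k
  exact hx k hxD

theorem IsWeakCurl.congr {d : ℕ} {D : Set (Vec d)} (hD : MeasurableSet D) {u : Vec d → Vec d}
    {g g' : Vec d → Vec (curlDim d)} (h : IsWeakCurl D u g) (hloc : LocallyIntegrableOn g' D)
    (heq : ∀ᵐ x, x ∈ D → g' x = g x) : IsWeakCurl D u g' := by
  refine ⟨h.locInt, hloc, fun φ hφ k => ?_⟩
  rw [← h.byParts φ hφ k]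
  refine setIntegral_congr_ae hD ?_
  filter_upwards [heq] with x hx hxD
  rw [hx hxD]

/-- A field whose weak derivatives up to order three are bounded has an element curl. -/
theorem exists_isElementCurl {d : ℕ} {K : Finset (Vec d)} {u : Vec d → Vec d} {M : ℝ} (hM : 0 ≤ M)
    (hu : WeakDerivBound 3 (interior (body K)) u M) {g : Vec d → Vec (curlDim d)}
    (h : IsWeakCurl (interior (body K)) u g) (hg : IntegrableOn g (interior (body K))) :
    ∃ g', IsElementCurl K u g' := by
  have hD : MeasurableSet (interior (body K)) := measurableSet_interior
  have key : ∀ k, ∃ g' : Vec d → ℝ, Continuous g' ∧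
      ∀ᵐ x, x ∈ interior (body K) → g' x = g x k := fun k => by
    obtain ⟨g', hlip, hae⟩ := exists_lipschitz_representative (M := ⟨d * (2 * M), by positivity⟩)
      isOpen_interior (convex_convexHull ℝ _).interior (integrable_extComp hD hg k)
      (h.gradBound hD hu hg k)
    refine ⟨g', hlip.continuous, ?_⟩
    filter_upwards [hae] with x hx hxD
    rw [hx hxD, extComp, indicator_of_mem hxD]
  choose g' hc hae using key
  have hcont : Continuous fun x => WithLp.toLp 2 fun k => g' k x :=
    (PiLp.continuous_toLp 2 _).comp (continuous_pi hc)
  refine ⟨fun x => WithLp.toLp 2 fun k => g' k x, hcont.continuousOn, ?_⟩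
  refine h.congr hD (hcont.locallyIntegrable.locallyIntegrableOn _) ?_
  filter_upwards [ae_all_iff.2 hae] with x hx hxD
  ext k
  exact hx k hxD

theorem isElementCurl_elementCurl {d : ℕ} {K : Finset (Vec d)} {u : Vec d → Vec d}
    (h : ∃ g, IsElementCurl K u g) : IsElementCurl K u (elementCurl K u) := by
  rw [elementCurl, dif_pos h]
  exact h.choose_spec

/-! ### Square integrable divergence and curl -/

theorem abs_integral_mul_le_sqrt {d : ℕ} {a b : Vec d → ℝ} (ha : MemLp a 2) (hb : MemLp b 2) :
    |∫ x, a x * b x| ≤ √(∫ x, a x ^ 2) * √(∫ x, b x ^ 2) := by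
  have hab : Integrable fun x => a x * b x := ha.integrable_mul hb
  have h1 : ∀ t : ℝ, 0 ≤ (∫ x, a x ^ 2) * (t * t) + (2 * ∫ x, a x * b x) * t + ∫ x, b x ^ 2 := by
    intro t
    have h2 : ∫ x, (t * a x + b x) ^ 2 =
        (∫ x, a x ^ 2) * (t * t) + (2 * ∫ x, a x * b x) * t + ∫ x, b x ^ 2 := by
      have h3 : ∀ x, (t * a x + b x) ^ 2 = t * t * a x ^ 2 + 2 * t * (a x * b x) + b x ^ 2 :=
        fun x => by ring
      have hi : Integrable fun x => t * t * a x ^ 2 + 2 * t * (a x * b x) :=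
        (ha.integrable_sq.const_mul _).add (hab.const_mul _)
      simp only [h3]
      rw [integral_add hi hb.integrable_sq,
        integral_add (ha.integrable_sq.const_mul _) (hab.const_mul _), integral_const_mul,
        integral_const_mul]
      ring
    rw [← h2]
    exact integral_nonneg fun x => sq_nonneg _
  have h4 := discrim_le_zero h1
  rw [discrim] at h4
  rw [← Real.sqrt_mul (integral_nonneg fun x => sq_nonneg _)]
  apply Real.abs_le_sqrt
  nlinarith

theorem integral_mul_dirDeriv {d : ℕ} {φ ψ : Vec d → ℝ} (hφ : IsTest univ φ)
    (hψ : IsTest univ ψ) (v : Vec d) :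
    ∫ x, φ x * dirDeriv v ψ x = - ∫ x, dirDeriv v φ x * ψ x :=
  integral_mul_fderiv_eq_neg_fderiv_mul_of_integrable
    (hψ.integrable_mul (hφ.dirDeriv v).integrable) ((hψ.dirDeriv v).integrable_mul hφ.integrable)
    (hψ.integrable_mul hφ.integrable) (fun x _ => hφ.differentiable x)
    (fun x _ => hψ.differentiable x)

theorem dirDeriv_comm {d : ℕ} {D : Set (Vec d)} {φ : Vec d → ℝ} (hφ : IsTest D φ) (v w : Vec d) :
    dirDeriv v (dirDeriv w φ) = dirDeriv w (dirDeriv v φ) := by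
  have hdiff : Differentiable ℝ (fderiv ℝ φ) :=
    (hφ.smooth.fderiv_right (m := ∞) (by simp)).differentiable (by simp)
  have key : ∀ a b x, dirDeriv a (dirDeriv b φ) x = fderiv ℝ (fderiv ℝ φ) x a b := by
    intro a b x
    have h1 := (hdiff x).hasFDerivAt.clm_apply (hasFDerivAt_const b x)
    have h2 : fderiv ℝ (dirDeriv b φ) x = _ := h1.fderiv
    rw [dirDeriv, h2]
    simp
  ext x
  rw [key, key]
  exact (hφ.smooth.contDiffAt.isSymmSndFDerivAt
    (by simpa using WithTop.coe_le_coe.2 (le_top : (2 : ℕ∞) ≤ ⊤))) v w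

theorem integral_dirDeriv_mul_dirDeriv {d : ℕ} {φ ψ : Vec d → ℝ} (hφ : IsTest univ φ)
    (hψ : IsTest univ ψ) (v w : Vec d) :
    ∫ x, dirDeriv v φ x * dirDeriv w ψ x = ∫ x, dirDeriv w φ x * dirDeriv v ψ x := by
  have h1 := integral_mul_dirDeriv hφ (hψ.dirDeriv w) v
  have h2 := integral_mul_dirDeriv hφ (hψ.dirDeriv v) w
  rw [dirDeriv_comm hψ v w] at h1
  linarith

/-- For a smooth compactly supported field, the gradient is controlled in `L²` by the divergence
and the curl. -/
theorem integral_sq_dirDeriv_le {n : ℕ} {w : Fin n → Vec n → ℝ} (hw : ∀ k, IsTest univ (w k))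
    (j k : Fin n) :
    ∫ x, dirDeriv (basisVec j) (w k) x ^ 2 ≤
      (∫ x, (∑ i, dirDeriv (basisVec i) (w i) x) ^ 2) + 1 / 2 * ∑ a, ∑ b,
        ∫ x, (dirDeriv (basisVec a) (w b) x - dirDeriv (basisVec b) (w a) x) ^ 2 := by
  set D : Fin n → Fin n → Vec n → ℝ := fun a b => dirDeriv (basisVec a) (w b) with hD
  have hT : ∀ a b, IsTest univ (D a b) := fun a b => (hw b).dirDeriv _
  have hint : ∀ a b a' b', Integrable fun x => D a b x * D a' b' x := fun a b a' b' =>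
    (hT a' b').integrable_mul (hT a b).integrable
  have h1 : ∫ x, (∑ i, D i i x) ^ 2 = ∑ a, ∑ b, ∫ x, D a b x * D b a x := by
    have e : ∀ x, (∑ i, D i i x) ^ 2 = ∑ a, ∑ b, D a a x * D b b x := fun x => by
      rw [sq, Finset.sum_mul_sum]
    simp only [e]
    rw [integral_finsetSum _ fun a _ => integrable_finsetSum _ fun b _ => hint a a b b]
    refine Finset.sum_congr rfl fun a _ => ?_
    rw [integral_finsetSum _ fun b _ => hint a a b b]
    refine Finset.sum_congr rfl fun b _ => ?_
    rw [integral_dirDeriv_mul_dirDeriv (hw a) (hw b)]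
    simp only [hD, mul_comm]
  have h2 : ∀ a b, ∫ x, (D a b x - D b a x) ^ 2 =
      (∫ x, D a b x * D a b x) + (∫ x, D b a x * D b a x) - 2 * ∫ x, D a b x * D b a x := by
    intro a b
    have e : ∀ x, (D a b x - D b a x) ^ 2 =
        D a b x * D a b x + D b a x * D b a x - 2 * (D a b x * D b a x) := fun x => by ring
    have hi : Integrable fun x => D a b x * D a b x + D b a x * D b a x :=
      (hint a b a b).add (hint b a b a)
    simp only [e]
    rw [integral_sub hi ((hint a b b a).const_mul 2),
      integral_add (hint a b a b) (hint b a b a), integral_const_mul]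
  have h3 : (∫ x, (∑ i, D i i x) ^ 2) + 1 / 2 * ∑ a, ∑ b, ∫ x, (D a b x - D b a x) ^ 2 =
      ∑ a, ∑ b, ∫ x, D a b x * D a b x := by
    simp only [h1, h2, Finset.sum_sub_distrib, Finset.sum_add_distrib, ← Finset.mul_sum]
    rw [Finset.sum_comm (f := fun a b => ∫ x, D b a x * D b a x)]
    ring
  change ∫ x, D j k x ^ 2 ≤ (∫ x, (∑ i, D i i x) ^ 2) + 1 / 2 * ∑ a, ∑ b,
    ∫ x, (D a b x - D b a x) ^ 2
  rw [h3]
  have hnn : ∀ a b, 0 ≤ ∫ x, D a b x * D a b x := fun a b =>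
    integral_nonneg fun x => mul_self_nonneg _
  calc ∫ x, D j k x ^ 2 = ∫ x, D j k x * D j k x := by simp only [sq]
    _ ≤ ∑ b, ∫ x, D j b x * D j b x :=
        Finset.single_le_sum (f := fun b => ∫ x, D j b x * D j b x) (fun b _ => hnn j b)
          (Finset.mem_univ k)
    _ ≤ _ := Finset.single_le_sum (f := fun a => ∑ b, ∫ x, D a b x * D a b x)
          (fun a _ => Finset.sum_nonneg fun b _ => hnn a b) (Finset.mem_univ j)

theorem isTest_smear {d : ℕ} {g θ : Vec d → ℝ} (hg : Integrable g) (hgc : HasCompactSupport g)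
    (hθ : IsTest univ θ) : IsTest univ (smear g θ) :=
  ⟨contDiff_smear hg hθ, by
    rw [smear_eq_convolution]
    exact HasCompactSupport.convolution _ hgc hθ.compact, subset_univ _⟩

theorem isTest_univ_reflect {d : ℕ} {θ : Vec d → ℝ} (hθ : IsTest univ θ) (x : Vec d) :
    IsTest univ (reflect θ x) := by
  obtain ⟨r, hr⟩ := hθ.compact.isCompact.isBounded.subset_closedBall 0
  exact isTest_reflect hθ hr (subset_univ _)

theorem sq_smear_le {d : ℕ} {p : Vec d → ℝ} (hp : Integrable p) (hp2 : MemLp p 2) (n : ℕ)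
    (x : Vec d) :
    smear p (mollifier d n) x ^ 2 ≤ smear (fun y => p y ^ 2) (mollifier d n) x := by
  set m := smear p (mollifier d n) x with hm
  have ht : IsTest univ (reflect (mollifier d n) x) := isTest_univ_reflect (isTest_mollifier d n) x
  have h1 : 0 ≤ ∫ y, (p y - m) ^ 2 * reflect (mollifier d n) x y :=
    integral_nonneg fun y => mul_nonneg (sq_nonneg _) (mollifier_nonneg d n _)
  have e : ∀ y, (p y - m) ^ 2 * reflect (mollifier d n) x y =
      p y ^ 2 * reflect (mollifier d n) x y - 2 * m * (p y * reflect (mollifier d n) x y) +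
        m ^ 2 * reflect (mollifier d n) x y := fun y => by ring
  have hi : Integrable fun y => p y ^ 2 * reflect (mollifier d n) x y -
      2 * m * (p y * reflect (mollifier d n) x y) :=
    (ht.integrable_mul hp2.integrable_sq).sub ((ht.integrable_mul hp).const_mul _)
  simp only [e] at h1
  rw [integral_add hi (ht.integrable.const_mul _),
    integral_sub (ht.integrable_mul hp2.integrable_sq) ((ht.integrable_mul hp).const_mul _),
    integral_const_mul, integral_const_mul, integral_reflect, integral_mollifier,
    ← smear_eq_integral_reflect p, ← hm] at h1
  have h2 : smear (fun y => p y ^ 2) (mollifier d n) x =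
    ∫ y, p y ^ 2 * reflect (mollifier d n) x y := rfl
  rw [h2]
  linarith

theorem integral_sq_smear_le {d : ℕ} {p : Vec d → ℝ} (hp : Integrable p) (hp2 : MemLp p 2)
    (n : ℕ) : ∫ x, smear p (mollifier d n) x ^ 2 ≤ ∫ x, p x ^ 2 := by
  have hint : Integrable (smear (fun y => p y ^ 2) (mollifier d n)) :=
    hp2.integrable_sq.integrable_convolution (ContinuousLinearMap.mul ℝ ℝ)
      (isTest_mollifier d n).integrable
  have h1 : ∫ x, smear (fun y => p y ^ 2) (mollifier d n) x = ∫ x, p x ^ 2 := by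
    have := integral_convolution (ContinuousLinearMap.mul ℝ ℝ) hp2.integrable_sq
      (isTest_mollifier d n).integrable (μ := volume) (ν := volume)
    rw [smear_eq_convolution, this, integral_mollifier]
    simp
  rw [← h1]
  exact integral_mono_of_nonneg (Eventually.of_forall fun x => sq_nonneg _) hint
    (Eventually.of_forall fun x => sq_smear_le hp hp2 n x)

theorem integral_smear_mul {d : ℕ} {w θ : Vec d → ℝ} (hw : Integrable w) (hθ : Integrable θ)
    (n : ℕ) :
    ∫ x, smear w (mollifier d n) x * θ x = ∫ y, w y * smear θ (mollifier d n) y := by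
  have hsymm : ∀ x y : Vec d, mollifier d n (x - y) = mollifier d n (y - x) := fun x y => by
    rw [mollifier, ← (bump d n).normed_neg, neg_sub]
  obtain ⟨B, -, hB⟩ := (isTest_mollifier d n).exists_bound
  have hint : Integrable (fun z : Vec d × Vec d => (θ z.1 * w z.2) * mollifier d n (z.1 - z.2))
      (volume.prod volume) :=
    (hθ.mul_prod hw).mul_bdd (c := B)
      ((isTest_mollifier d n).continuous.comp (by fun_prop)).aestronglyMeasurable
      (Eventually.of_forall fun z => hB _)
  calc ∫ x, smear w (mollifier d n) x * θ x
      = ∫ x, ∫ y, (θ x * w y) * mollifier d n (x - y) := by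
        congr 1
        ext x
        rw [smear, ← integral_mul_const]
        congr 1
        ext y
        ring
    _ = ∫ y, ∫ x, (θ x * w y) * mollifier d n (x - y) := integral_integral_swap hint
    _ = ∫ y, w y * smear θ (mollifier d n) y := by
        congr 1
        ext y
        rw [smear, ← integral_const_mul]
        congr 1
        ext x
        rw [hsymm]
        ring

theorem tendsto_integral_smear_mul {d : ℕ} {w θ : Vec d → ℝ} (hw : Integrable w)
    (hθ : IsTest univ θ) :
    Tendsto (fun n => ∫ x, smear w (mollifier d n) x * θ x) atTop (𝓝 (∫ x, w x * θ x)) := by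
  simp only [integral_smear_mul hw hθ.integrable]
  obtain ⟨B, hB0, hB⟩ := hθ.exists_bound
  refine tendsto_integral_of_dominated_convergence (fun x => ‖w x‖ * B) (fun n => ?_)
    (hw.norm.mul_const B) (fun n => Eventually.of_forall fun x => ?_)
    (Eventually.of_forall fun x => ?_)
  · exact hw.aestronglyMeasurable.mul
      (contDiff_smear hθ.integrable (isTest_mollifier d n)).continuous.aestronglyMeasurable
  · rw [norm_mul]
    gcongr
    have ht := isTest_univ_reflect (isTest_mollifier d n) x
    have h1 : ‖∫ y, θ y * reflect (mollifier d n) x y‖ ≤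
        ∫ y, B * reflect (mollifier d n) x y := by
      refine norm_integral_le_of_norm_le (ht.integrable.const_mul B)
        (Eventually.of_forall fun y => ?_)
      have hnn : 0 ≤ reflect (mollifier d n) x y := mollifier_nonneg d n _
      rw [norm_mul, Real.norm_of_nonneg hnn]
      exact mul_le_mul_of_nonneg_right (hB y) hnn
    rw [integral_const_mul, integral_reflect, integral_mollifier, mul_one] at h1
    exact h1
  · exact (tendsto_smear hθ.continuous.aestronglyMeasurable
      hθ.continuous.continuousAt).const_mul (w x)

/-- A compactly supported field with square integrable weak divergence and curl has a square
integrable weak gradient. -/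
theorem exists_bound_of_div_curl {n : ℕ} {w : Fin n → Vec n → ℝ} {p : Vec n → ℝ}
    {r : Fin n → Fin n → Vec n → ℝ} (hw : ∀ k, Integrable (w k))
    (hwc : ∀ k, HasCompactSupport (w k)) (hp : Integrable p) (hp2 : MemLp p 2)
    (hr : ∀ j k, Integrable (r j k)) (hr2 : ∀ j k, MemLp (r j k) 2)
    (hdiv : ∀ ψ, IsTest univ ψ → ∑ k, ∫ x, w k x * dirDeriv (basisVec k) ψ x = ∫ x, p x * ψ x)
    (hcurl : ∀ ψ, IsTest univ ψ → ∀ j k, (∫ x, w k x * dirDeriv (basisVec j) ψ x) -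
      ∫ x, w j x * dirDeriv (basisVec k) ψ x = ∫ x, r j k x * ψ x) :
    ∃ A, ∀ j k ψ, IsTest univ ψ →
      |∫ x, w k x * dirDeriv (basisVec j) ψ x| ≤ A * √(∫ x, ψ x ^ 2) := by
  refine ⟨√((∫ x, p x ^ 2) + 1 / 2 * ∑ a, ∑ b, ∫ x, r a b x ^ 2), fun j k ψ hψ => ?_⟩
  refine le_of_tendsto (tendsto_integral_smear_mul (hw k) (hψ.dirDeriv (basisVec j))).abs
    (Eventually.of_forall fun m => ?_)
  have hρ := isTest_mollifier n m
  set W : Fin n → Vec n → ℝ := fun k => smear (w k) (mollifier n m) with hW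
  have hWt : ∀ k, IsTest univ (W k) := fun k => isTest_smear (hw k) (hwc k) hρ
  have hDW : ∀ a b x, dirDeriv (basisVec a) (W b) x =
      - ∫ y, w b y * dirDeriv (basisVec a) (reflect (mollifier n m) x) y := fun a b x => by
    rw [hW, dirDeriv_smear (hw b) hρ, smear_dirDeriv _ hρ.differentiable]
  have e1 : ∀ x, ∑ i, dirDeriv (basisVec i) (W i) x = - smear p (mollifier n m) x := fun x => by
    simp only [hDW, Finset.sum_neg_distrib]
    rw [hdiv _ (isTest_univ_reflect hρ x), smear_eq_integral_reflect]
  have e2 : ∀ a b x, dirDeriv (basisVec a) (W b) x - dirDeriv (basisVec b) (W a) x =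
      - smear (r a b) (mollifier n m) x := fun a b x => by
    rw [hDW, hDW, smear_eq_integral_reflect, ← hcurl _ (isTest_univ_reflect hρ x)]
    ring
  have h1 := integral_sq_dirDeriv_le hWt j k
  simp only [e1, e2, neg_sq] at h1
  have h2 : ∫ x, dirDeriv (basisVec j) (W k) x ^ 2 ≤
      (∫ x, p x ^ 2) + 1 / 2 * ∑ a, ∑ b, ∫ x, r a b x ^ 2 := by
    refine h1.trans (add_le_add (integral_sq_smear_le hp hp2 m) ?_)
    exact mul_le_mul_of_nonneg_left (Finset.sum_le_sum fun a _ => Finset.sum_le_sum fun b _ =>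
      integral_sq_smear_le (hr a b) (hr2 a b) m) (by norm_num)
  change |∫ x, W k x * dirDeriv (basisVec j) ψ x| ≤ _
  rw [integral_mul_dirDeriv (hWt k) hψ, abs_neg]
  refine (abs_integral_mul_le_sqrt (((hWt k).dirDeriv _).memLp 2) (hψ.memLp 2)).trans ?_
  gcongr

theorem exists_cutoff {d : ℕ} {S U : Set (Vec d)} (hS : IsCompact S) (hU : IsOpen U)
    (hSU : S ⊆ U) :
    ∃ χ : Vec d → ℝ, IsTest U χ ∧ (∀ᶠ x in 𝓝ˢ S, χ x = 1) ∧ ∀ x, χ x ∈ Icc (0 : ℝ) 1 := by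
  obtain ⟨L, hL, hSL, hLU⟩ := exists_compact_between hS hU hSU
  obtain ⟨χ, h1, h2, h3⟩ := exists_contMDiffMap_one_nhds_of_subset_interior (n := ⊤)
    𝓘(ℝ, Vec d) hS.isClosed hSL
  have hsupp : tsupport χ ⊆ L := closure_minimal
    (fun x hx => by_contra fun h => hx (h2 x h)) hL.isClosed
  exact ⟨χ, ⟨χ.contMDiff.contDiff, HasCompactSupport.of_support_subset_isCompact hL
    (subset_closure.trans hsupp), hsupp.trans hLU⟩, h1, h3⟩

theorem IsTest.memLp_mul {d : ℕ} {D : Set (Vec d)} {φ g : Vec d → ℝ} {p : ℝ≥0∞} (h : IsTest D φ)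
    (hg : MemLp g p) : MemLp (fun x => g x * φ x) p := by
  obtain ⟨B, -, hB⟩ := h.exists_bound
  refine hg.of_le_mul (c := B) (hg.1.mul h.continuous.aestronglyMeasurable)
    (Eventually.of_forall fun x => ?_)
  rw [norm_mul, mul_comm]
  gcongr
  exact hB x

theorem dirDeriv_mul {d : ℕ} {φ ψ : Vec d → ℝ} (hφ : Differentiable ℝ φ) (hψ : Differentiable ℝ ψ)
    (v x : Vec d) :
    dirDeriv v (fun y => φ y * ψ y) x = φ x * dirDeriv v ψ x + ψ x * dirDeriv v φ x := by
  have h1 : fderiv ℝ (fun y => φ y * ψ y) x = _ :=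
    ((hφ x).hasFDerivAt.mul (hψ x).hasFDerivAt).fderiv
  rw [dirDeriv, h1]
  simp [dirDeriv]

/-- Interior regularity: a field with vanishing weak divergence and square integrable weak curl on
an open set has a locally square integrable weak gradient there. -/
theorem exists_local_bound_of_div_curl {n : ℕ} {U S : Set (Vec n)} (hU : IsOpen U)
    (hS : IsCompact S) (hSU : S ⊆ U) {c : Fin n → Vec n → ℝ}
    {F : Fin n → Fin n → Vec n → ℝ} (hc : ∀ k, Integrable (c k)) (hc2 : ∀ k, MemLp (c k) 2)
    (hF : ∀ j k, Integrable (F j k)) (hF2 : ∀ j k, MemLp (F j k) 2)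
    (hdiv : ∀ ψ, IsTest U ψ → ∑ k, ∫ x, c k x * dirDeriv (basisVec k) ψ x = 0)
    (hcurl : ∀ ψ, IsTest U ψ → ∀ j k, (∫ x, c k x * dirDeriv (basisVec j) ψ x) -
      ∫ x, c j x * dirDeriv (basisVec k) ψ x = ∫ x, F j k x * ψ x) :
    ∃ A, ∀ j k ψ, IsTest S ψ →
      |∫ x, c k x * dirDeriv (basisVec j) ψ x| ≤ A * √(∫ x, ψ x ^ 2) := by
  obtain ⟨χ, hχ, hχ1, -⟩ := exists_cutoff hS hU hSU
  have hχS : ∀ x ∈ S, χ x = 1 := fun x hx => (hχ1.self_of_nhdsSet) x hx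
  set w : Fin n → Vec n → ℝ := fun k x => c k x * χ x with hw
  set p : Vec n → ℝ := fun x => - ∑ k, c k x * dirDeriv (basisVec k) χ x with hp
  set r : Fin n → Fin n → Vec n → ℝ := fun j k x => F j k x * χ x -
    (c k x * dirDeriv (basisVec j) χ x - c j x * dirDeriv (basisVec k) χ x) with hr
  have hI : ∀ j k, Integrable fun x => c k x * dirDeriv (basisVec j) χ x := fun j k =>
    (hχ.dirDeriv _).integrable_mul (hc k)
  have hL : ∀ j k, MemLp (fun x => c k x * dirDeriv (basisVec j) χ x) 2 := fun j k =>
    (hχ.dirDeriv _).memLp_mul (hc2 k)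
  have hwψ : ∀ ψ, IsTest univ ψ → ∀ j k, ∫ x, w k x * dirDeriv (basisVec j) ψ x =
      (∫ x, c k x * dirDeriv (basisVec j) (fun y => ψ y * χ y) x) -
        ∫ x, c k x * dirDeriv (basisVec j) χ x * ψ x := by
    intro ψ hψ j k
    rw [← integral_sub (((hχ.mul hψ.smooth).dirDeriv _).integrable_mul (hc k))
      (hψ.integrable_mul (hI j k))]
    congr 1
    ext x
    rw [dirDeriv_mul hψ.differentiable hχ.differentiable, hw]
    ring
  obtain ⟨A, hA⟩ := exists_bound_of_div_curl (w := w) (p := p) (r := r)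
    (fun k => hχ.integrable_mul (hc k)) (fun k => hχ.compact.mul_left)
    (integrable_finsetSum _ fun k _ => hI k k).neg
    (memLp_finsetSum _ fun k _ => hL k k).neg
    (fun j k => (hχ.integrable_mul (hF j k)).sub ((hI j k).sub (hI k j)))
    (fun j k => (hχ.memLp_mul (hF2 j k)).sub ((hL j k).sub (hL k j)))
    (fun ψ hψ => by
      simp only [hwψ ψ hψ]
      rw [Finset.sum_sub_distrib, hdiv _ (hχ.mul hψ.smooth),
        ← integral_finsetSum _ fun k _ => hψ.integrable_mul (hI k k), zero_sub, ← integral_neg]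
      simp only [hp, Finset.sum_mul, neg_mul])
    (fun ψ hψ j k => by
      rw [hwψ ψ hψ, hwψ ψ hψ]
      have e : ∀ x, r j k x * ψ x = F j k x * (ψ x * χ x) -
        (c k x * dirDeriv (basisVec j) χ x * ψ x - c j x * dirDeriv (basisVec k) χ x * ψ x) :=
        fun x => by simp only [hr]; ring
      have hi : Integrable fun x => c k x * dirDeriv (basisVec j) χ x * ψ x -
          c j x * dirDeriv (basisVec k) χ x * ψ x :=
        (hψ.integrable_mul (hI j k)).sub (hψ.integrable_mul (hI k j))
      simp only [e]
      rw [integral_sub ((hχ.mul hψ.smooth).integrable_mul (hF j k)) hi,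
        integral_sub (hψ.integrable_mul (hI j k)) (hψ.integrable_mul (hI k j)),
        ← hcurl _ (hχ.mul hψ.smooth)]
      ring)
  refine ⟨A, fun j k ψ hψ => ?_⟩
  have h1 := hA j k ψ (hψ.mono (subset_univ _))
  have h2 : ∀ x, w k x * dirDeriv (basisVec j) ψ x = c k x * dirDeriv (basisVec j) ψ x := by
    intro x
    by_cases hx : x ∈ S
    · simp only [hw, hχS x hx, mul_one]
    · rw [(hψ.dirDeriv _).eq_zero hx, mul_zero, mul_zero]
  simpa only [h2] using h1

/-! ### Consequences of the source problem -/

theorem memLp_extComp {d m : ℕ} {D : Set (Vec d)} (hD : MeasurableSet D) {g : Vec d → Vec m}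
    {p : ℝ≥0∞} (hg : MemLp g p (volume.restrict D)) (k : Fin m) : MemLp (extComp D g k) p := by
  rw [extComp, memLp_indicator_iff_restrict hD]
  exact (EuclideanSpace.proj (𝕜 := ℝ) k : Vec m →L[ℝ] ℝ).comp_memLp' hg

theorem integrableOn_of_memLp_two {d m : ℕ} {D : Set (Vec d)} (hD : Bornology.IsBounded D)
    {g : Vec d → Vec m} (hg : MemLp g 2 (volume.restrict D)) : IntegrableOn g D := by
  have : IsFiniteMeasure (volume.restrict D) := ⟨by simpa using hD.measure_lt_top⟩
  exact hg.integrable (by norm_num)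

/-- The curl of the field `ψ eᵢ`. -/
def testCurl {d : ℕ} (ψ : Vec d → ℝ) (i : Fin d) (x : Vec d) : Vec (curlDim d) :=
  WithLp.toLp 2 fun k =>
    basisVec i (curlPair d k).2 * dirDeriv (basisVec (curlPair d k).1) ψ x -
      basisVec i (curlPair d k).1 * dirDeriv (basisVec (curlPair d k).2) ψ x

theorem isHZeroCurl_testCurl {d : ℕ} {Ω : Set (Vec d)} {ψ : Vec d → ℝ}
    (hψ : IsTest Ω ψ) (i : Fin d) :
    IsHZeroCurl Ω (fun x => ψ x • basisVec i) (testCurl ψ i) := by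
  have hψu := hψ.mono (subset_univ Ω)
  refine ⟨?_, ?_, ?_⟩
  · refine (Continuous.memLp_of_hasCompactSupport ?_ ?_).restrict Ω
    · exact hψ.continuous.smul continuous_const
    · exact hψ.compact.smul_right
  · refine (Continuous.memLp_of_hasCompactSupport ?_ ?_).restrict Ω
    · refine (PiLp.continuous_toLp 2 _).comp (continuous_pi fun k => ?_)
      exact (continuous_const.mul (hψ.dirDeriv _).continuous).sub
        (continuous_const.mul (hψ.dirDeriv _).continuous)
    · refine HasCompactSupport.of_support_subset_isCompact hψ.compact fun x hx => ?_
      by_contra h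
      apply hx
      have hS : IsTest (tsupport ψ) ψ := ⟨hψ.smooth, hψ.compact, subset_rfl⟩
      ext k
      simp [testCurl, (hS.dirDeriv _).eq_zero h]
  · intro φ hφ k
    set a := (curlPair d k).1
    set b := (curlPair d k).2
    have hi : ∀ c, Integrable fun x => ψ x * dirDeriv (basisVec c) φ x := fun c =>
      (hφ.dirDeriv _).integrable_mul hψ.integrable
    have hi' : ∀ c, Integrable fun x => dirDeriv (basisVec c) ψ x * φ x := fun c =>
      hφ.integrable_mul (hψ.dirDeriv _).integrable
    rw [setIntegral_eq_integral_of_forall_compl_eq_zero,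
      setIntegral_eq_integral_of_forall_compl_eq_zero]
    · have e1 : ∀ x, testCurl ψ i x k * φ x =
          basisVec i b * (dirDeriv (basisVec a) ψ x * φ x) -
            basisVec i a * (dirDeriv (basisVec b) ψ x * φ x) := fun x => by
        simp only [testCurl, a, b]; ring
      have e2 : ∀ x, (ψ x • basisVec i : Vec d) a * fderiv ℝ φ x (basisVec b) -
          (ψ x • basisVec i : Vec d) b * fderiv ℝ φ x (basisVec a) =
          basisVec i a * (ψ x * dirDeriv (basisVec b) φ x) -
            basisVec i b * (ψ x * dirDeriv (basisVec a) φ x) := fun x => by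
        simp only [dirDeriv, PiLp.smul_apply, smul_eq_mul]; ring
      simp only [e1, e2]
      rw [integral_sub ((hi' a).const_mul _) ((hi' b).const_mul _),
        integral_sub ((hi b).const_mul _) ((hi a).const_mul _)]
      simp only [integral_const_mul]
      rw [integral_mul_dirDeriv hψu hφ, integral_mul_dirDeriv hψu hφ]
      ring
    · intro x hx
      simp [hψ.eq_zero hx]
    · intro x hx
      simp [testCurl, (hψ.dirDeriv _).eq_zero hx]

theorem IsSourceSolution.integral_curl_test {d : ℕ} {Ω : Set (Vec d)} (hΩ : IsOpen Ω)
    (hb : Bornology.IsBounded Ω) {f u : Vec d → Vec d} {c : Vec d → Vec (curlDim d)}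
    {s : Vec d → ℝ} {gs : Vec d → Vec d} (h : IsSourceSolution Ω f u c s gs)
    (hf : MemLp f 2 (volume.restrict Ω)) {ψ : Vec d → ℝ} (hψ : IsTest Ω ψ) (i : Fin d) :
    ∑ k, ((basisVec i (curlPair d k).2 *
        ∫ x, extComp Ω c k x * dirDeriv (basisVec (curlPair d k).1) ψ x) -
      basisVec i (curlPair d k).1 *
        ∫ x, extComp Ω c k x * dirDeriv (basisVec (curlPair d k).2) ψ x) =
      ∫ x, extComp Ω (fun x => f x - gs x) i x * ψ x := by
  have hc := integrableOn_of_memLp_two hb h.mem_u.memLp_curl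
  have hF := integrableOn_of_memLp_two hb hf
  have hG := integrableOn_of_memLp_two hb h.mem_s.memLp_grad
  have key := h.eq_curl _ _ (isHZeroCurl_testCurl hψ i)
  have e1 : ∀ g : Vec d → Vec d, ∀ x, inner ℝ (g x) (ψ x • basisVec i : Vec d) = g x i * ψ x :=
    fun g x => by simp [inner_smul_right, basisVec, EuclideanSpace.inner_single_right, mul_comm]
  have e2 : ∀ x, inner ℝ (c x) (testCurl ψ i x) = ∑ k, (basisVec i (curlPair d k).2 *
      (c x k * dirDeriv (basisVec (curlPair d k).1) ψ x) - basisVec i (curlPair d k).1 *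
      (c x k * dirDeriv (basisVec (curlPair d k).2) ψ x)) := fun x => by
    rw [PiLp.inner_apply]
    refine Finset.sum_congr rfl fun k _ => ?_
    simp only [testCurl, RCLike.inner_apply, conj_trivial]
    ring
  have hI : ∀ k a, IntegrableOn (fun x => c x k * dirDeriv (basisVec a) ψ x) Ω := fun k a =>
    integrableOn_coord_mul hc.locallyIntegrableOn k (hψ.dirDeriv _)
  simp only [e1, e2] at key
  have hi : ∀ k, IntegrableOn (fun x => basisVec i (curlPair d k).2 *
      (c x k * dirDeriv (basisVec (curlPair d k).1) ψ x) - basisVec i (curlPair d k).1 *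
      (c x k * dirDeriv (basisVec (curlPair d k).2) ψ x)) Ω := fun k =>
    ((hI k _).const_mul _).sub ((hI k _).const_mul _)
  rw [integral_finsetSum _ fun k _ => hi k] at key
  have e3 : ∀ k, ∫ x in Ω, (basisVec i (curlPair d k).2 *
      (c x k * dirDeriv (basisVec (curlPair d k).1) ψ x) - basisVec i (curlPair d k).1 *
      (c x k * dirDeriv (basisVec (curlPair d k).2) ψ x)) =
      (basisVec i (curlPair d k).2 *
        ∫ x, extComp Ω c k x * dirDeriv (basisVec (curlPair d k).1) ψ x) -
      basisVec i (curlPair d k).1 *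
        ∫ x, extComp Ω c k x * dirDeriv (basisVec (curlPair d k).2) ψ x := fun k => by
    rw [integral_sub ((hI k _).const_mul _) ((hI k _).const_mul _), integral_const_mul,
      integral_const_mul, integral_extComp_mul hΩ.measurableSet,
      integral_extComp_mul hΩ.measurableSet]
  simp only [e3] at key
  rw [eq_sub_of_add_eq key, integral_extComp_mul hΩ.measurableSet, ← integral_sub
    (integrableOn_coord_mul hF.locallyIntegrableOn i hψ)
    (integrableOn_coord_mul hG.locallyIntegrableOn i hψ)]
  congr 1
  ext x
  simp only [PiLp.sub_apply]
  ring

theorem IsHZeroCurl.integral_extComp {d : ℕ} {Ω : Set (Vec d)} (hΩ : IsOpen Ω)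
    (hb : Bornology.IsBounded Ω) {u : Vec d → Vec d} {c : Vec d → Vec (curlDim d)}
    (h : IsHZeroCurl Ω u c) {φ : Vec d → ℝ} (hφ : IsTest Ω φ) (k : Fin (curlDim d)) :
    ∫ x, extComp Ω c k x * φ x =
      (∫ x, extComp Ω u (curlPair d k).1 x * dirDeriv (basisVec (curlPair d k).2) φ x) -
        ∫ x, extComp Ω u (curlPair d k).2 x * dirDeriv (basisVec (curlPair d k).1) φ x := by
  have hu := (integrableOn_of_memLp_two hb h.memLp).locallyIntegrableOn
  simp only [integral_extComp_mul hΩ.measurableSet]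
  rw [h.byParts φ (hφ.mono (subset_univ _)) k, ← integral_sub
    (integrableOn_coord_mul hu _ (hφ.dirDeriv _)) (integrableOn_coord_mul hu _ (hφ.dirDeriv _))]
  rfl

theorem IsHZeroCurl.sum_integral_eq_zero {Ω : Set (Vec 3)} (hΩ : IsOpen Ω)
    (hb : Bornology.IsBounded Ω) {u : Vec 3 → Vec 3} {c : Vec 3 → Vec 3}
    (h : IsHZeroCurl Ω u c) {ψ : Vec 3 → ℝ} (hψ : IsTest Ω ψ) :
    ∑ k, ∫ x, extComp Ω c k x * dirDeriv (basisVec k) ψ x = 0 := by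
  have h0 := h.integral_extComp hΩ hb (hψ.dirDeriv (basisVec 0)) (0 : Fin 3)
  have h1 := h.integral_extComp hΩ hb (hψ.dirDeriv (basisVec 1)) (1 : Fin 3)
  have h2 := h.integral_extComp hΩ hb (hψ.dirDeriv (basisVec 2)) (2 : Fin 3)
  simp only [curlPair, Matrix.cons_val] at h0 h1 h2
  rw [Fin.sum_univ_three]
  rw [dirDeriv_comm hψ (basisVec 2) (basisVec 0), dirDeriv_comm hψ (basisVec 1) (basisVec 0)] at h0
  rw [dirDeriv_comm hψ (basisVec 2) (basisVec 1)] at h1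
  have e0 : ∫ x, extComp Ω c 0 x * dirDeriv (basisVec 0) ψ x = _ := h0
  have e1 : ∫ x, extComp Ω c 1 x * dirDeriv (basisVec 1) ψ x = _ := h1
  have e2 : ∫ x, extComp Ω c 2 x * dirDeriv (basisVec 2) ψ x = _ := h2
  rw [e0, e1, e2]
  ring

theorem exists_antisymm_curl {Ω : Set (Vec 3)} (hΩ : IsOpen Ω)
    (hb : Bornology.IsBounded Ω) {f u : Vec 3 → Vec 3} {c : Vec 3 → Vec 3}
    {s : Vec 3 → ℝ} {gs : Vec 3 → Vec 3} (h : IsSourceSolution Ω f u c s gs)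
    (hf : MemLp f 2 (volume.restrict Ω)) (j k : Fin 3) :
    ∃ F : Vec 3 → ℝ, Integrable F ∧ MemLp F 2 ∧ ∀ ψ, IsTest Ω ψ →
      (∫ x, extComp Ω c k x * dirDeriv (basisVec j) ψ x) -
        ∫ x, extComp Ω c j x * dirDeriv (basisVec k) ψ x = ∫ x, F x * ψ x := by
  have hmem : MemLp (fun x => f x - gs x) 2 (volume.restrict Ω) := hf.sub h.mem_s.memLp_grad
  have hF2 : ∀ i, MemLp (extComp Ω (fun x => f x - gs x) i) 2 := fun i =>
    memLp_extComp hΩ.measurableSet hmem i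
  have hF : ∀ i, Integrable (extComp Ω (fun x => f x - gs x) i) := fun i =>
    integrable_extComp hΩ.measurableSet (integrableOn_of_memLp_two hb hmem) i
  have key : ∀ ψ, IsTest Ω ψ → ∀ i : Fin 3, ∑ k : Fin 3, ((basisVec i (curlPair 3 k).2 *
        ∫ x, extComp Ω c k x * dirDeriv (basisVec (curlPair 3 k).1) ψ x) -
      basisVec i (curlPair 3 k).1 *
        ∫ x, extComp Ω c k x * dirDeriv (basisVec (curlPair 3 k).2) ψ x) =
      ∫ x, extComp Ω (fun x => f x - gs x) i x * ψ x :=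
    fun ψ hψ i => h.integral_curl_test hΩ hb hf hψ i
  have pos : ∀ i (j k : Fin 3), (∀ ψ, IsTest Ω ψ →
      (∫ x, extComp Ω c k x * dirDeriv (basisVec j) ψ x) -
        ∫ x, extComp Ω c j x * dirDeriv (basisVec k) ψ x =
          ∫ x, extComp Ω (fun x => f x - gs x) i x * ψ x) →
      ∃ F : Vec 3 → ℝ, Integrable F ∧ MemLp F 2 ∧ ∀ ψ, IsTest Ω ψ →
      (∫ x, extComp Ω c k x * dirDeriv (basisVec j) ψ x) -
        ∫ x, extComp Ω c j x * dirDeriv (basisVec k) ψ x = ∫ x, F x * ψ x :=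
    fun i j k h => ⟨_, hF i, hF2 i, h⟩
  have neg : ∀ i (j k : Fin 3), (∀ ψ, IsTest Ω ψ →
      (∫ x, extComp Ω c j x * dirDeriv (basisVec k) ψ x) -
        ∫ x, extComp Ω c k x * dirDeriv (basisVec j) ψ x =
          ∫ x, extComp Ω (fun x => f x - gs x) i x * ψ x) →
      ∃ F : Vec 3 → ℝ, Integrable F ∧ MemLp F 2 ∧ ∀ ψ, IsTest Ω ψ →
      (∫ x, extComp Ω c k x * dirDeriv (basisVec j) ψ x) -
        ∫ x, extComp Ω c j x * dirDeriv (basisVec k) ψ x = ∫ x, F x * ψ x :=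
    fun i j k h => ⟨_, (hF i).neg, (hF2 i).neg, fun ψ hψ => by
      rw [← neg_sub, h ψ hψ, ← integral_neg]; simp⟩
  have hdiag : ∀ j : Fin 3, ∃ F : Vec 3 → ℝ, Integrable F ∧ MemLp F 2 ∧ ∀ ψ, IsTest Ω ψ →
      (∫ x, extComp Ω c j x * dirDeriv (basisVec j) ψ x) -
        ∫ x, extComp Ω c j x * dirDeriv (basisVec j) ψ x = ∫ x, F x * ψ x :=
    fun j => ⟨0, integrable_zero _ _ _, MemLp.zero, fun ψ _ => by simp⟩
  have f0 : ∀ ψ, IsTest Ω ψ → (∫ x, extComp Ω c 1 x * dirDeriv (basisVec 2) ψ x) -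
      ∫ x, extComp Ω c 2 x * dirDeriv (basisVec 1) ψ x =
        ∫ x, extComp Ω (fun x => f x - gs x) 0 x * ψ x := fun ψ hψ => by
    rw [← key ψ hψ 0, Fin.sum_univ_three]
    simp [curlPair, basisVec]
    ring
  have f1 : ∀ ψ, IsTest Ω ψ → (∫ x, extComp Ω c 2 x * dirDeriv (basisVec 0) ψ x) -
      ∫ x, extComp Ω c 0 x * dirDeriv (basisVec 2) ψ x =
        ∫ x, extComp Ω (fun x => f x - gs x) 1 x * ψ x := fun ψ hψ => by
    rw [← key ψ hψ 1, Fin.sum_univ_three]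
    simp [curlPair, basisVec]
    ring
  have f2 : ∀ ψ, IsTest Ω ψ → (∫ x, extComp Ω c 0 x * dirDeriv (basisVec 1) ψ x) -
      ∫ x, extComp Ω c 1 x * dirDeriv (basisVec 0) ψ x =
        ∫ x, extComp Ω (fun x => f x - gs x) 2 x * ψ x := fun ψ hψ => by
    rw [← key ψ hψ 2, Fin.sum_univ_three]
    simp [curlPair, basisVec]
    ring
  fin_cases j <;> fin_cases k
  · exact hdiag 0
  · exact neg 2 0 1 f2
  · exact pos 1 0 2 f1
  · exact pos 2 1 0 f2
  · exact hdiag 1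
  · exact neg 0 1 2 f0
  · exact neg 1 2 0 f1
  · exact pos 0 2 1 f0
  · exact hdiag 2

/-- The curl of the solution of the source problem has a locally square integrable weak
gradient. -/
theorem IsSourceSolution.exists_local_bound {d : ℕ} (hd : d = 2 ∨ d = 3) {Ω : Set (Vec d)}
    (hΩ : IsOpen Ω) (hb : Bornology.IsBounded Ω) {f u : Vec d → Vec d}
    {c : Vec d → Vec (curlDim d)} {s : Vec d → ℝ} {gs : Vec d → Vec d}
    (h : IsSourceSolution Ω f u c s gs) (hf : MemLp f 2 (volume.restrict Ω)) {S : Set (Vec d)}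
    (hS : IsCompact S) (hSΩ : S ⊆ Ω) :
    ∃ A, ∀ j k ψ, IsTest S ψ →
      |∫ x, extComp Ω c k x * dirDeriv (basisVec j) ψ x| ≤ A * √(∫ x, ψ x ^ 2) := by
  rcases hd with rfl | rfl
  · have hmem : MemLp (fun x => f x - gs x) 2 (volume.restrict Ω) := hf.sub h.mem_s.memLp_grad
    set N : Fin 2 → ℝ := fun i => √(∫ x, extComp Ω (fun x => f x - gs x) i x ^ 2) with hN
    have key : ∀ i ψ, IsTest S ψ → |∫ x, extComp Ω (fun x => f x - gs x) i x * ψ x| ≤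
        (N 0 + N 1) * √(∫ x, ψ x ^ 2) := fun i ψ hψ => by
      refine (abs_integral_mul_le_sqrt (memLp_extComp hΩ.measurableSet hmem i)
        (hψ.memLp 2)).trans ?_
      have h0 : 0 ≤ N 0 := Real.sqrt_nonneg _
      have h1 : 0 ≤ N 1 := Real.sqrt_nonneg _
      refine mul_le_mul_of_nonneg_right ?_ (Real.sqrt_nonneg _)
      change N i ≤ N 0 + N 1
      fin_cases i
      · exact le_add_of_nonneg_right h1
      · exact le_add_of_nonneg_left h0
    refine ⟨N 0 + N 1, fun j k ψ hψ => ?_⟩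
    have hk : k = (0 : Fin 1) := Subsingleton.elim (α := Fin 1) _ _
    have eq : ∀ i : Fin 2, ∑ k : Fin 1, ((basisVec i (curlPair 2 k).2 *
        ∫ x, extComp Ω c k x * dirDeriv (basisVec (curlPair 2 k).1) ψ x) -
      basisVec i (curlPair 2 k).1 *
        ∫ x, extComp Ω c k x * dirDeriv (basisVec (curlPair 2 k).2) ψ x) =
      ∫ x, extComp Ω (fun x => f x - gs x) i x * ψ x :=
      fun i => h.integral_curl_test hΩ hb hf (hψ.mono hSΩ) i
    rw [hk]
    fin_cases j
    · have h1 := eq 1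
      rw [Fin.sum_univ_one] at h1
      simp [curlPair, basisVec] at h1
      have h2 := key 1 ψ hψ
      rw [← h1] at h2
      exact h2
    · have h1 := eq 0
      rw [Fin.sum_univ_one] at h1
      simp [curlPair, basisVec] at h1
      have h2 := key 0 ψ hψ
      rw [← h1, abs_neg] at h2
      exact h2
  · choose F hF hF2 hcurl using exists_antisymm_curl hΩ hb h hf
    exact exists_local_bound_of_div_curl (c := fun k : Fin 3 => extComp Ω c k) hΩ hS hSΩ
      (fun k => integrable_extComp hΩ.measurableSet
        (integrableOn_of_memLp_two hb h.mem_u.memLp_curl) k)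
      (fun k => memLp_extComp hΩ.measurableSet h.mem_u.memLp_curl k) hF hF2
      (fun ψ hψ => h.mem_u.sum_integral_eq_zero hΩ hb hψ) (fun ψ hψ j k => hcurl j k ψ hψ)

/-! ### Geometry of the domain and of the mesh -/

theorem IsLipschitzDomain.graph_eq {d : ℕ} {Ω : Set (Vec d)} (hΩ : IsLipschitzDomain Ω)
    {p ν : Vec d} (hp : p ∈ frontier Ω) {γ : Vec d → ℝ} (hγ : Continuous γ) {U : Set (Vec d)}
    (hU : IsOpen U) (hpU : p ∈ U) (h : ∀ x ∈ U, x ∈ Ω ↔ γ x < inner ℝ ν x) :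
    γ p = inner ℝ ν p := by
  have hin : Continuous fun x : Vec d => inner ℝ ν x := continuous_const.inner continuous_id
  refine le_antisymm ?_ ?_
  · have hcl : p ∈ closure (Ω ∩ U) := by
      rw [mem_closure_iff_nhds]
      intro V hV
      obtain ⟨y, hy1, hy2⟩ := mem_closure_iff_nhds.1 hp.1 (V ∩ U)
        (inter_mem hV (hU.mem_nhds hpU))
      exact ⟨y, hy1.1, hy2, hy1.2⟩
    have hsub : Ω ∩ U ⊆ {x | γ x ≤ inner ℝ ν x} := fun x hx => ((h x hx.2).1 hx.1).le
    exact closure_minimal hsub (isClosed_le hγ hin) hcl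
  · by_contra hlt
    have := (h p hpU).2 (not_le.1 hlt)
    rw [frontier, hΩ.isOpen.interior_eq] at hp
    exact hp.2 this

theorem IsLipschitzDomain.interior_closure_subset {d : ℕ} {Ω : Set (Vec d)}
    (hΩ : IsLipschitzDomain Ω) : interior (closure Ω) ⊆ Ω := by
  intro p hp
  by_contra hpΩ
  have hfr : p ∈ frontier Ω := by
    rw [frontier, hΩ.isOpen.interior_eq]
    exact ⟨interior_subset hp, hpΩ⟩
  obtain ⟨ν, γ, L, U, hν, hγ, hinv, hU, hpU, h⟩ := hΩ.graph p hfr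
  have heq := hΩ.graph_eq hfr hγ.continuous hU hpU h
  have hcont : Tendsto (fun t : ℝ => p + (-t) • ν) (𝓝[>] 0) (𝓝 p) := by
    have : Continuous fun t : ℝ => p + (-t) • ν := by fun_prop
    simpa using (this.tendsto 0).mono_left nhdsWithin_le_nhds
  have h1 : ∀ᶠ t in 𝓝[>] (0 : ℝ), p + (-t) • ν ∈ U ∩ interior (closure Ω) :=
    hcont.eventually (inter_mem (hU.mem_nhds hpU) (isOpen_interior.mem_nhds hp))
  obtain ⟨t, ⟨htU, htc⟩, ht⟩ := (h1.and self_mem_nhdsWithin).exists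
  have ht0 : 0 < t := ht
  set q := p + (-t) • ν with hq
  have hin : inner ℝ ν q < γ q := by
    rw [hinv, heq, hq, inner_add_right, inner_smul_right, real_inner_self_eq_norm_sq, hν]
    linarith
  have hopen : IsOpen {x : Vec d | inner ℝ ν x < γ x} :=
    isOpen_lt (continuous_const.inner continuous_id) hγ.continuous
  obtain ⟨y, hy, hyΩ⟩ := mem_closure_iff_nhds.1 (interior_subset htc) _
    (inter_mem (hU.mem_nhds htU) (hopen.mem_nhds hin))
  exact lt_asymm ((h y hy.1).1 hyΩ) hy.2

theorem isCompact_body {d : ℕ} (K : Finset (Vec d)) : IsCompact (body K) :=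
  K.finite_toSet.isCompact_convexHull ℝ

theorem IsTriangulation.finite_elements {d : ℕ} {Ω : Set (Vec d)} {T : Mesh d}
    (hT : IsTriangulation Ω T) : (elements T).Finite :=
  hT.finite.subset fun _ hK => hK.1

theorem IsTriangulation.interior_body_subset {d : ℕ} {Ω : Set (Vec d)} (hΩ : IsLipschitzDomain Ω)
    {T : Mesh d} (hT : IsTriangulation Ω T) {K : Finset (Vec d)} (hK : K ∈ elements T) :
    interior (body K) ⊆ Ω := by
  refine (interior_mono ?_).trans hΩ.interior_closure_subset
  rw [← hT.cover]
  exact T.convexHull_subset_space hK.1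

theorem IsTriangulation.exists_mem_body {d : ℕ} {Ω : Set (Vec d)} {T : Mesh d}
    (hT : IsTriangulation Ω T) {x : Vec d} (hx : x ∈ T.space) : ∃ K ∈ elements T, x ∈ body K := by
  obtain ⟨s, hs, hxs⟩ := T.mem_space_iff.1 hx
  obtain ⟨K, hK, hsK⟩ := hT.pure s hs
  exact ⟨K, hK, convexHull_mono (by exact_mod_cast hsK) hxs⟩

theorem affineSpan_eq_top_iff_card {d : ℕ} {s : Finset (Vec d)}
    (hs : AffineIndependent ℝ ((↑) : s → Vec d)) :
    affineSpan ℝ (s : Set (Vec d)) = ⊤ ↔ s.card = d + 1 := by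
  have := hs.affineSpan_eq_top_iff_card_eq_finrank_add_one
  rw [Subtype.range_coe_subtype, Fintype.card_coe, finrank_euclideanSpace, Fintype.card_fin] at this
  exact this

theorem interior_body_nonempty {d : ℕ} {T : Mesh d} {K : Finset (Vec d)} (hK : K ∈ elements T) :
    (interior (body K)).Nonempty := by
  rw [interior_convexHull_nonempty_iff_affineSpan_eq_top]
  exact (affineSpan_eq_top_iff_card (T.indep hK.1)).2 hK.2

theorem disjoint_interior_body {d : ℕ} {T : Mesh d} {K K' : Finset (Vec d)}
    (hK : K ∈ elements T) (hK' : K' ∈ elements T) (hne : K ≠ K') :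
    Disjoint (interior (body K)) (interior (body K')) := by
  classical
  rw [Set.disjoint_iff_inter_eq_empty, ← interior_inter]
  by_contra hnonempty
  rw [← Ne, ← nonempty_iff_ne_empty] at hnonempty
  have h1 : body K ∩ body K' = convexHull ℝ ((K ∩ K' : Finset (Vec d)) : Set (Vec d)) := by
    rw [Finset.coe_inter]
    exact T.convexHull_inter_convexHull hK.1 hK'.1
  rw [h1, interior_convexHull_nonempty_iff_affineSpan_eq_top] at hnonempty
  have hind : AffineIndependent ℝ ((↑) : (K ∩ K' : Finset (Vec d)) → Vec d) :=
    (T.indep hK.1).mono (by simp)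
  rw [affineSpan_eq_top_iff_card hind] at hnonempty
  have e1 : K ∩ K' = K := Finset.eq_of_subset_of_card_le Finset.inter_subset_left
    (by rw [hnonempty, hK.2])
  have e2 : K ∩ K' = K' := Finset.eq_of_subset_of_card_le Finset.inter_subset_right
    (by rw [hnonempty, hK'.2])
  exact hne (e1.symm.trans e2)

/-- The union of the boundaries of the elements. -/
def skeleton {d : ℕ} (T : Mesh d) : Set (Vec d) := ⋃ K ∈ elements T, frontier (body K)

theorem IsTriangulation.isCompact_skeleton {d : ℕ} {Ω : Set (Vec d)} {T : Mesh d}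
    (hT : IsTriangulation Ω T) : IsCompact (skeleton T) :=
  hT.finite_elements.isCompact_biUnion fun K _ =>
    (isCompact_body K).of_isClosed_subset isClosed_frontier
      (isCompact_body K).isClosed.frontier_subset

theorem IsTriangulation.volume_skeleton {d : ℕ} {Ω : Set (Vec d)} {T : Mesh d}
    (hT : IsTriangulation Ω T) : volume (skeleton T) = 0 :=
  (measure_biUnion_null_iff hT.finite_elements.countable).2 fun _ _ =>
    (convex_convexHull ℝ _).addHaar_frontier volume

theorem IsTriangulation.exists_mem_interior {d : ℕ} {Ω : Set (Vec d)} {T : Mesh d}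
    (hT : IsTriangulation Ω T) {x : Vec d} (hx : x ∈ Ω) (hxs : x ∉ skeleton T) :
    ∃ K ∈ elements T, x ∈ interior (body K) := by
  obtain ⟨K, hK, hxK⟩ := hT.exists_mem_body (hT.cover ▸ subset_closure hx)
  refine ⟨K, hK, by_contra fun h => hxs ?_⟩
  exact mem_biUnion hK ⟨subset_closure hxK, h⟩

theorem IsHZeroCurl.isWeakCurl {d : ℕ} {Ω D : Set (Vec d)} (hΩ : IsOpen Ω)
    (hb : Bornology.IsBounded Ω) {u : Vec d → Vec d} {c : Vec d → Vec (curlDim d)}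
    (h : IsHZeroCurl Ω u c) (hD : D ⊆ Ω) : IsWeakCurl D u c := by
  refine ⟨((integrableOn_of_memLp_two hb h.memLp).mono_set hD).locallyIntegrableOn,
    ((integrableOn_of_memLp_two hb h.memLp_curl).mono_set hD).locallyIntegrableOn,
    fun φ hφ k => ?_⟩
  have h1 := h.byParts φ (hφ.mono (subset_univ _)) k
  rw [setIntegral_eq_of_subset_of_forall_sdiff_eq_zero hΩ.measurableSet hD,
    setIntegral_eq_of_subset_of_forall_sdiff_eq_zero hΩ.measurableSet hD] at h1
  · exact h1
  · intro x hx
    have e : ∀ v, fderiv ℝ φ x v = 0 := fun v => (hφ.dirDeriv v).eq_zero hx.2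
    simp [e]
  · intro x hx
    simp [hφ.eq_zero hx.2]

/-! ### The curl has a bounded weak gradient on the whole domain -/

theorem isTest_indicator {d : ℕ} {D B : Set (Vec d)} {ψ : Vec d → ℝ} (hψ : IsTest D ψ)
    (hB : Disjoint (tsupport ψ) (frontier B)) :
    IsTest (interior B) ((interior B).indicator ψ) := by
  have hsupp : tsupport ((interior B).indicator ψ) ⊆ interior B := by
    have h1 : tsupport ((interior B).indicator ψ) ⊆ tsupport ψ ∩ closure B := by
      refine closure_minimal ?_ ((isClosed_tsupport ψ).inter isClosed_closure)
      rw [Set.support_indicator]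
      exact fun x hx => ⟨subset_closure hx.2, subset_closure (interior_subset hx.1)⟩
    intro x hx
    by_contra h
    exact disjoint_left.1 hB (h1 hx).1 ⟨(h1 hx).2, h⟩
  refine ⟨contDiff_iff_contDiffAt.2 fun x => ?_, ?_, hsupp⟩
  · by_cases hx : x ∈ tsupport ((interior B).indicator ψ)
    · refine hψ.smooth.contDiffAt.congr_of_eventuallyEq ?_
      filter_upwards [isOpen_interior.mem_nhds (hsupp hx)] with y hy
      exact indicator_of_mem hy ψ
    · refine (contDiffAt_const (c := (0 : ℝ))).congr_of_eventuallyEq ?_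
      filter_upwards [(isClosed_tsupport _).isOpen_compl.mem_nhds hx] with y hy
      exact image_eq_zero_of_notMem_tsupport hy
  · refine HasCompactSupport.of_support_subset_isCompact hψ.compact ?_
    rw [Set.support_indicator]
    exact inter_subset_right.trans subset_closure

theorem dirDeriv_finsetSum {d : ℕ} {ι : Type*} (s : Finset ι) {D : ι → Set (Vec d)}
    {ψ : ι → Vec d → ℝ} (hψ : ∀ i ∈ s, IsTest (D i) (ψ i)) (v x : Vec d) :
    dirDeriv v (fun y => ∑ i ∈ s, ψ i y) x = ∑ i ∈ s, dirDeriv v (ψ i) x := by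
  have h1 := HasFDerivAt.fun_sum (u := s) (x := x) fun i hi =>
    ((hψ i hi).differentiable x).hasFDerivAt
  rw [dirDeriv, h1.fderiv]
  simp [dirDeriv]

theorem integral_extComp_mul_dirDeriv_of_subset {d m : ℕ} {D Ω : Set (Vec d)} (hD : D ⊆ Ω)
    (c : Vec d → Vec m) (k : Fin m) {ψ : Vec d → ℝ} (hψ : IsTest D ψ) (v : Vec d) :
    ∫ x, extComp Ω c k x * dirDeriv v ψ x = ∫ x, extComp D c k x * dirDeriv v ψ x := by
  congr 1
  ext x
  by_cases hx : x ∈ D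
  · simp [extComp, hx, hD hx]
  · simp [(hψ.dirDeriv v).eq_zero hx]

/-- Away from the skeleton, the weak gradient of the curl is controlled elementwise. -/
theorem abs_integral_le_of_disjoint_skeleton {d : ℕ} {Ω : Set (Vec d)}
    (hΩ : IsLipschitzDomain Ω) {T : Mesh d} (hT : IsTriangulation Ω T) {u : Vec d → Vec d}
    {c : Vec d → Vec (curlDim d)} (hu : IsHZeroCurl Ω u c) (hpw : MemPW Ω T u)
    (k : Fin (curlDim d)) (j : Fin d) {ψ : Vec d → ℝ} (hψ : IsTest Ω ψ)
    (hdisj : Disjoint (tsupport ψ) (skeleton T)) :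
    |∫ x, extComp Ω c k x * dirDeriv (basisVec j) ψ x| ≤
      2 * (pwNorm T u).toReal * ∫ x, |ψ x| := by
  set s := hT.finite_elements.toFinset with hs
  have hmem : ∀ K, K ∈ s ↔ K ∈ elements T := fun K => by simp [hs]
  set ψK : Finset (Vec d) → Vec d → ℝ := fun K => (interior (body K)).indicator ψ with hψK
  have htest : ∀ K ∈ s, IsTest (interior (body K)) (ψK K) := fun K hK =>
    isTest_indicator hψ (hdisj.mono_right
      (subset_biUnion_of_mem (u := fun K => frontier (body K)) ((hmem K).1 hK)))
  have hsum : ∀ F : ℝ → ℝ, F 0 = 0 → ∀ x, F (ψ x) = ∑ K ∈ s, F (ψK K x) := by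
    intro F hF x
    by_cases hx : ψ x = 0
    · rw [hx, hF]
      refine (Finset.sum_eq_zero fun K _ => ?_).symm
      by_cases hxK : x ∈ interior (body K) <;> simp [hψK, hxK, hx, hF]
    · have hxΩ : x ∈ Ω := by_contra fun h => hx (hψ.eq_zero h)
      have hxs : x ∉ skeleton T := disjoint_left.1 hdisj (subset_tsupport ψ hx)
      obtain ⟨K, hK, hxK⟩ := hT.exists_mem_interior hxΩ hxs
      rw [Finset.sum_eq_single K]
      · simp [hψK, hxK]
      · intro K' hK' hne
        have : x ∉ interior (body K') :=
          disjoint_left.1 (disjoint_interior_body hK ((hmem K').1 hK') hne.symm) hxK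
        simp [hψK, this, hF]
      · exact fun h => absurd ((hmem K).2 hK) h
  have hc : Integrable (extComp Ω c k) := integrable_extComp hΩ.isOpen.measurableSet
    (integrableOn_of_memLp_two hΩ.isBounded hu.memLp_curl) k
  have h1 : ∫ x, extComp Ω c k x * dirDeriv (basisVec j) ψ x =
      ∑ K ∈ s, ∫ x, extComp (interior (body K)) c k x * dirDeriv (basisVec j) (ψK K) x := by
    have e : ψ = fun y => ∑ K ∈ s, ψK K y := funext (hsum id rfl)
    have e' : ∀ x, extComp Ω c k x * dirDeriv (basisVec j) ψ x =
        ∑ K ∈ s, extComp Ω c k x * dirDeriv (basisVec j) (ψK K) x := fun x => by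
      conv_lhs => rw [e, dirDeriv_finsetSum s htest, Finset.mul_sum]
    simp only [e']
    rw [integral_finsetSum _ fun K hK => ((htest K hK).dirDeriv _).integrable_mul hc]
    exact Finset.sum_congr rfl fun K hK => integral_extComp_mul_dirDeriv_of_subset
      (hT.interior_body_subset hΩ ((hmem K).1 hK)) c k (htest K hK) _
  have h2 : ∫ x, |ψ x| = ∑ K ∈ s, ∫ x, |ψK K x| := by
    simp only [hsum (fun t => |t|) abs_zero]
    exact integral_finsetSum _ fun K hK => (htest K hK).integrable.abs
  rw [h1, h2, Finset.mul_sum]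
  refine (Finset.abs_sum_le_sum_abs _ _).trans (Finset.sum_le_sum fun K hK => ?_)
  exact (hu.isWeakCurl hΩ.isOpen hΩ.isBounded
    (hT.interior_body_subset hΩ ((hmem K).1 hK))).abs_integral_dirDeriv_le measurableSet_interior
    (weakDerivBound_pwNorm hT.finite hpw ((hmem K).1 hK)) k j (htest K hK)

theorem integral_sq_mul_le {d : ℕ} {U : Set (Vec d)} {η φ : Vec d → ℝ} (hη : IsTest U η)
    (hη1 : ∀ x, η x ∈ Icc (0 : ℝ) 1) {B δ : ℝ} (hB : ∀ x, |φ x| ≤ B)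
    (hδ : 0 < δ) (hU : volume U < ENNReal.ofReal δ) :
    ∫ x, (η x * φ x) ^ 2 ≤ B ^ 2 * δ := by
  have h1 : ∫ x in U, (η x * φ x) ^ 2 = ∫ x, (η x * φ x) ^ 2 :=
    setIntegral_eq_integral_of_forall_compl_eq_zero fun x hx => by simp [hη.eq_zero hx]
  have h2 : ‖∫ x in U, (η x * φ x) ^ 2‖ ≤ B ^ 2 * volume.real U := by
    refine norm_setIntegral_le_of_norm_le_const (hU.trans ENNReal.ofReal_lt_top) fun x _ => ?_
    rw [norm_pow, norm_mul, Real.norm_eq_abs, Real.norm_eq_abs]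
    have h3 : |η x| ≤ 1 := abs_le.2 ⟨by linarith [(hη1 x).1], (hη1 x).2⟩
    have h4 : |η x| * |φ x| ≤ B := by
      nlinarith [abs_nonneg (η x), abs_nonneg (φ x), hB x]
    gcongr
  rw [← h1]
  refine (le_abs_self _).trans (h2.trans ?_)
  gcongr
  exact ENNReal.toReal_le_of_le_ofReal hδ.le hU.le

/-- The curl of the solution has a bounded weak gradient on the whole domain. -/
theorem IsSourceSolution.gradBound {d : ℕ} (hd : d = 2 ∨ d = 3) {Ω : Set (Vec d)}
    (hΩ : IsLipschitzDomain Ω) {T : Mesh d} (hT : IsTriangulation Ω T) {f u : Vec d → Vec d}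
    {c : Vec d → Vec (curlDim d)} {s : Vec d → ℝ} {gs : Vec d → Vec d}
    (h : IsSourceSolution Ω f u c s gs) (hf : MemLp f 2 (volume.restrict Ω)) (hpw : MemPW Ω T u)
    (k : Fin (curlDim d)) :
    GradBound Ω (extComp Ω c k) (d * (2 * (pwNorm T u).toReal)) := by
  have hc : Integrable (extComp Ω c k) := integrable_extComp hΩ.isOpen.measurableSet
    (integrableOn_of_memLp_two hΩ.isBounded h.mem_u.memLp_curl) k
  refine gradBound_of_basisVec hc fun j φ hφ => le_of_forall_pos_le_add fun ε hε => ?_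
  obtain ⟨A, hA⟩ := h.exists_local_bound hd hΩ.isOpen hΩ.isBounded hf hφ.compact hφ.support
  obtain ⟨B, hB0, hB⟩ := hφ.exists_bound
  set r : ℝ := ε / (|A| * B + 1) with hr
  have hr0 : 0 < r := by positivity
  obtain ⟨U, hZU, hU, hUv⟩ := Set.exists_isOpen_lt_of_lt (μ := volume) (skeleton T)
    (ENNReal.ofReal (r ^ 2)) (by rw [hT.volume_skeleton]; simpa using pow_pos hr0 2)
  obtain ⟨η, hη, hη1, hη01⟩ := exists_cutoff hT.isCompact_skeleton hU hZU
  have hηφ : IsTest Ω fun x => η x * φ x := hφ.mul hη.smooth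
  have hηφS : IsTest (tsupport φ) fun x => η x * φ x :=
    (show IsTest (tsupport φ) φ from ⟨hφ.smooth, hφ.compact, subset_rfl⟩).mul hη.smooth
  set ψ : Vec d → ℝ := fun x => φ x - η x * φ x with hψ
  have hψt : IsTest Ω ψ := hφ.sub hηφ
  have hdisj : Disjoint (tsupport ψ) (skeleton T) := by
    rw [disjoint_right]
    intro x hx
    rw [notMem_tsupport_iff_eventuallyEq]
    filter_upwards [(eventually_nhdsSet_iff_forall.1 hη1) x hx] with y hy
    simp [hψ, hy]
  have h1 := abs_integral_le_of_disjoint_skeleton hΩ hT h.mem_u hpw k j hψt hdisj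
  have h2 := hA j k _ hηφS
  have h3 : √(∫ x, (η x * φ x) ^ 2) ≤ B * r := by
    rw [← Real.sqrt_sq (mul_nonneg hB0 hr0.le), mul_pow]
    exact Real.sqrt_le_sqrt (integral_sq_mul_le hη hη01 hB (by positivity) hUv)
  have h4 : A * √(∫ x, (η x * φ x) ^ 2) ≤ ε := by
    calc A * √(∫ x, (η x * φ x) ^ 2) ≤ |A| * (B * r) :=
          mul_le_mul (le_abs_self A) h3 (Real.sqrt_nonneg _) (abs_nonneg A)
      _ ≤ (|A| * B + 1) * r := by nlinarith
      _ = ε := by rw [hr]; field_simp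
  have h5 : ∫ x, |ψ x| ≤ ∫ x, |φ x| := by
    refine integral_mono hψt.integrable.abs hφ.integrable.abs fun x => ?_
    have e : ψ x = (1 - η x) * φ x := by simp only [hψ]; ring
    simp only [e, abs_mul]
    have : |1 - η x| ≤ 1 := abs_le.2 ⟨by linarith [(hη01 x).2], by linarith [(hη01 x).1]⟩
    nlinarith [abs_nonneg (φ x)]
  have h6 : ∫ x, extComp Ω c k x * dirDeriv (basisVec j) φ x =
      (∫ x, extComp Ω c k x * dirDeriv (basisVec j) ψ x) +
        ∫ x, extComp Ω c k x * dirDeriv (basisVec j) (fun y => η y * φ y) x := by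
    rw [← integral_add ((hψt.dirDeriv _).integrable_mul hc) ((hηφ.dirDeriv _).integrable_mul hc)]
    congr 1
    ext x
    have e : dirDeriv (basisVec j) ψ x = dirDeriv (basisVec j) φ x -
        dirDeriv (basisVec j) (fun y => η y * φ y) x := by
      have h7 : fderiv ℝ ψ x = _ :=
        ((hφ.differentiable x).hasFDerivAt.sub (hηφ.differentiable x).hasFDerivAt).fderiv
      rw [dirDeriv, h7]
      rfl
    rw [e]
    ring
  rw [h6]
  refine (abs_add_le _ _).trans (add_le_add (h1.trans ?_) (h2.trans h4))
  gcongr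

/-! ### Continuity of the curl at the nodes -/

theorem tendsto_smear_of_ae_eq {d : ℕ} {D : Set (Vec d)} (hD : IsOpen D) {g h : Vec d → ℝ}
    (hg : AEStronglyMeasurable g volume) (hh : ContinuousOn h D)
    (heq : ∀ᵐ x, x ∈ D → h x = g x) {x : Vec d} (hx : x ∈ D) :
    Tendsto (fun n => smear g (mollifier d n) x) atTop (𝓝 (h x)) := by
  classical
  set g' : Vec d → ℝ := D.piecewise h g with hg'
  have hae : g' =ᵐ[volume] g := by
    filter_upwards [heq] with y hy
    by_cases hyD : y ∈ D
    · simp [hg', hyD, hy hyD]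
    · simp [hg', hyD]
  have h1 : ∀ n, smear g (mollifier d n) x = smear g' (mollifier d n) x := fun n => by
    refine integral_congr_ae ?_
    filter_upwards [hae] with y hy
    rw [hy]
  have hnear : g' =ᶠ[𝓝 x] h := by
    filter_upwards [hD.mem_nhds hx] with y hy
    simp [hg', hy]
  have hc : ContinuousAt g' x := (hh.continuousAt (hD.mem_nhds hx)).congr hnear.symm
  simp only [h1]
  rw [← hnear.self_of_nhds]
  exact tendsto_smear (hg.congr hae.symm) hc

/-- Near a point of its closure, any two points of a Lipschitz domain are joined inside the domain
by a polygonal path of comparable length. -/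
theorem IsLipschitzDomain.exists_path {d : ℕ} {Ω : Set (Vec d)} (hΩ : IsLipschitzDomain Ω)
    {z : Vec d} (hz : z ∈ closure Ω) :
    ∃ L r : ℝ, 0 < r ∧ ∀ x ∈ Ω ∩ Metric.ball z r, ∀ y ∈ Ω ∩ Metric.ball z r,
      ∃ p q : Vec d, segment ℝ x p ⊆ Ω ∧ segment ℝ p q ⊆ Ω ∧ segment ℝ q y ⊆ Ω ∧
        ‖p - x‖ + ‖q - p‖ + ‖y - q‖ ≤ L * (‖x - z‖ + ‖y - z‖) := by
  by_cases hzΩ : z ∈ Ω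
  · obtain ⟨r, hr, hball⟩ := Metric.isOpen_iff.1 hΩ.isOpen z hzΩ
    refine ⟨1, r, hr, fun x hx y hy => ⟨x, x, ?_, ?_, ?_, ?_⟩⟩
    · simpa [segment_same] using hx.1
    · simpa [segment_same] using hx.1
    · exact ((convex_ball z r).segment_subset hx.2 hy.2).trans hball
    · have := norm_sub_le (y - z) (x - z)
      rw [sub_sub_sub_cancel_right] at this
      simp only [sub_self, norm_zero]
      linarith
  · have hfr : z ∈ frontier Ω := by
      rw [frontier, hΩ.isOpen.interior_eq]
      exact ⟨hz, hzΩ⟩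
    obtain ⟨ν, γ, L, U, hν, hγ, hinv, hU, hzU, hgraph⟩ := hΩ.graph z hfr
    obtain ⟨R, hR, hball⟩ := Metric.isOpen_iff.1 hU z hzU
    have hL : (0 : ℝ) ≤ L := L.2
    refine ⟨2 * L + 3, R / (2 * (L + 2)), by positivity, fun x hx y hy => ?_⟩
    set ρ := ‖x - z‖ + ‖y - z‖ with hρ
    have hxr := hx.2
    have hyr := hy.2
    rw [Metric.mem_ball, dist_eq_norm] at hxr hyr
    have hρR : (L + 2) * ρ < R := by
      have h1 : ρ < R / (L + 2) := by
        have : R / (L + 2) = R / (2 * (L + 2)) + R / (2 * (L + 2)) := by field_simp; ring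
        linarith
      rw [lt_div_iff₀ (by positivity)] at h1
      linarith
    have hρ0 : 0 ≤ ρ := by positivity
    have hxy : ‖y - x‖ ≤ ρ := by
      have := norm_sub_le (y - z) (x - z)
      rw [sub_sub_sub_cancel_right] at this
      linarith
    set t := (L + 1) * ρ with ht
    have ht0 : 0 ≤ t := by positivity
    have hxU : x ∈ U := hball (by
      rw [Metric.mem_ball, dist_eq_norm]; nlinarith [norm_nonneg (y - z)])
    have hyU : y ∈ U := hball (by
      rw [Metric.mem_ball, dist_eq_norm]; nlinarith [norm_nonneg (x - z)])
    have hnear : ∀ v : Vec d, ‖v - z‖ ≤ ρ → ∀ τ : ℝ, 0 ≤ τ → τ ≤ t → v + τ • ν ∈ U := by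
      intro v hv τ hτ0 hτ
      apply hball
      rw [Metric.mem_ball, dist_eq_norm]
      have h1 : ‖v + τ • ν - z‖ ≤ ‖v - z‖ + ‖τ • ν‖ := by
        rw [add_sub_right_comm]; exact norm_add_le _ _
      rw [norm_smul, hν, Real.norm_of_nonneg hτ0] at h1
      nlinarith
    have hup : ∀ v ∈ Ω, v ∈ U → ‖v - z‖ ≤ ρ → segment ℝ v (v + t • ν) ⊆ Ω := by
      intro v hvΩ hvU hv w hw
      rw [segment_eq_image'] at hw
      obtain ⟨θ, ⟨hθ0, hθ1⟩, rfl⟩ := hw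
      have e : v + θ • (v + t • ν - v) = v + (θ * t) • ν := by
        rw [add_sub_cancel_left, smul_smul]
      simp only [e]
      have hτ0 : 0 ≤ θ * t := by positivity
      rw [hgraph _ (hnear v hv _ hτ0 (by nlinarith)), hinv, inner_add_right, inner_smul_right,
        real_inner_self_eq_norm_sq, hν]
      have := (hgraph v hvU).1 hvΩ
      linarith
    have hxz : ‖x - z‖ ≤ ρ := by linarith [norm_nonneg (y - z)]
    have hyz : ‖y - z‖ ≤ ρ := by linarith [norm_nonneg (x - z)]
    refine ⟨x + t • ν, y + t • ν, hup x hx.1 hxU hxz, ?_, ?_, ?_⟩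
    · intro w hw
      rw [segment_eq_image'] at hw
      obtain ⟨θ, ⟨hθ0, hθ1⟩, rfl⟩ := hw
      set v := x + θ • (y - x) with hv
      have e : x + t • ν + θ • (y + t • ν - (x + t • ν)) = v + t • ν := by
        rw [hv]; module
      simp only [e]
      have hvx : ‖v - x‖ ≤ ρ := by
        rw [hv, add_sub_cancel_left, norm_smul, Real.norm_of_nonneg hθ0]
        nlinarith [norm_nonneg (y - x)]
      have hvz : ‖v - z‖ ≤ ρ := by
        have e2 : v - z = (1 - θ) • (x - z) + θ • (y - z) := by rw [hv]; module
        rw [e2]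
        refine (norm_add_le _ _).trans ?_
        rw [norm_smul, norm_smul, Real.norm_of_nonneg hθ0,
          Real.norm_of_nonneg (by linarith : 0 ≤ 1 - θ)]
        nlinarith
      rw [hgraph _ (hnear v hvz t ht0 le_rfl), hinv, inner_add_right, inner_smul_right,
        real_inner_self_eq_norm_sq, hν]
      have h1 := (hgraph x hxU).1 hx.1
      have h2 : γ v ≤ γ x + L * ‖v - x‖ := by
        have := hγ.dist_le_mul v x
        rw [Real.dist_eq, dist_eq_norm] at this
        linarith [(abs_le.1 this).2]
      have h3 : inner ℝ ν x - inner ℝ ν v ≤ ‖v - x‖ := by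
        rw [← inner_sub_right, ← norm_sub_rev]
        simpa [hν] using real_inner_le_norm ν (x - v)
      have h4 : (L : ℝ) * ‖v - x‖ ≤ L * ρ := by gcongr
      nlinarith
    · rw [segment_symm]
      exact hup y hy.1 hyU hyz
    · have e1 : y + t • ν - (x + t • ν) = y - x := by abel
      have e2 : y - (y + t • ν) = -(t • ν) := by abel
      rw [e1, e2, add_sub_cancel_left, norm_neg, norm_smul, hν, Real.norm_of_nonneg ht0]
      nlinarith

theorem mem_closure_interior_body {d : ℕ} {T : Mesh d} {K : Finset (Vec d)}
    (hK : K ∈ elements T) {z : Vec d} (hz : z ∈ body K) : z ∈ closure (interior (body K)) := by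
  rw [(convex_convexHull ℝ _).closure_interior_eq_closure_of_nonempty_interior
    (interior_body_nonempty hK)]
  exact subset_closure hz

theorem integrableOn_elementCurl {d : ℕ} {K : Finset (Vec d)} {u : Vec d → Vec d}
    {g : Vec d → Vec (curlDim d)} (h : IsElementCurl K u g) :
    IntegrableOn g (interior (body K)) :=
  (h.1.integrableOn_compact (isCompact_body K)).mono_set interior_subset

theorem eq_of_gradBound {d m : ℕ} {Ω : Set (Vec d)} (hΩ : IsLipschitzDomain Ω) {T : Mesh d}
    (hT : IsTriangulation Ω T) {c : Vec d → Vec m} {k : Fin m} {M : ℝ} (hM : 0 ≤ M)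
    (hc : Integrable (extComp Ω c k)) (hb : GradBound Ω (extComp Ω c k) M)
    {K K' : Finset (Vec d)} (hK : K ∈ elements T) (hK' : K' ∈ elements T) {g g' : Vec d → Vec m}
    (hg : ContinuousOn g (body K)) (hg' : ContinuousOn g' (body K'))
    (hae : ∀ᵐ x, x ∈ interior (body K) → g x = c x)
    (hae' : ∀ᵐ x, x ∈ interior (body K') → g' x = c x) {z : Vec d} (hz : z ∈ body K)
    (hz' : z ∈ body K') : g z k = g' z k := by
  have hcl : z ∈ closure Ω := by
    rw [← hT.cover]
    exact T.convexHull_subset_space hK.1 hz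
  obtain ⟨L, r, hr, hpath⟩ := hΩ.exists_path hcl
  have hcomp : ∀ {K : Finset (Vec d)} {g : Vec d → Vec m}, ContinuousOn g (body K) →
      ContinuousOn (fun x => g x k) (body K) := fun hg =>
    (EuclideanSpace.proj (𝕜 := ℝ) k : Vec m →L[ℝ] ℝ).continuous.comp_continuousOn hg
  have hlim : ∀ {K : Finset (Vec d)} {g : Vec d → Vec m}, K ∈ elements T →
      ContinuousOn g (body K) → (∀ᵐ x, x ∈ interior (body K) → g x = c x) →
      ∀ x ∈ interior (body K),
        Tendsto (fun n => smear (extComp Ω c k) (mollifier d n) x) atTop (𝓝 (g x k)) := by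
    intro K g hK hg hae x hx
    refine tendsto_smear_of_ae_eq isOpen_interior hc.aestronglyMeasurable
      (h := fun x => g x k) ((hcomp hg).mono interior_subset) ?_ hx
    filter_upwards [hae] with y hy hyK
    rw [hy hyK, extComp, indicator_of_mem (hT.interior_body_subset hΩ hK hyK)]
  have key : ∀ x ∈ interior (body K) ∩ Metric.ball z r,
      ∀ y ∈ interior (body K') ∩ Metric.ball z r,
        |g' y k - g x k| ≤ M * (L * (‖x - z‖ + ‖y - z‖)) := by
    intro x hx y hy
    obtain ⟨p, q, h1, h2, h3, hlen⟩ := hpath x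
      ⟨hT.interior_body_subset hΩ hK hx.1, hx.2⟩ y ⟨hT.interior_body_subset hΩ hK' hy.1, hy.2⟩
    refine le_of_tendsto (((hlim hK' hg' hae' y hy.1).sub (hlim hK hg hae x hx.1)).abs) ?_
    filter_upwards [eventually_abs_smear_sub_le hΩ.isOpen hM hc hb h1,
      eventually_abs_smear_sub_le hΩ.isOpen hM hc hb h2,
      eventually_abs_smear_sub_le hΩ.isOpen hM hc hb h3] with n e1 e2 e3
    set s := smear (extComp Ω c k) (mollifier d n)
    have : |s y - s x| ≤ |s p - s x| + |s q - s p| + |s y - s q| := by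
      have e : s y - s x = (s p - s x) + (s q - s p) + (s y - s q) := by ring
      rw [e]
      exact (abs_add_le _ _).trans (add_le_add_left (abs_add_le _ _) _)
    refine this.trans ?_
    have := mul_le_mul_of_nonneg_left hlen hM
    linarith
  have hne : (𝓝[interior (body K)] z).NeBot :=
    mem_closure_iff_nhdsWithin_neBot.1 (mem_closure_interior_body hK hz)
  have hne' : (𝓝[interior (body K')] z).NeBot :=
    mem_closure_iff_nhdsWithin_neBot.1 (mem_closure_interior_body hK' hz')
  have t1 : Tendsto (fun x => g x k) (𝓝[interior (body K)] z) (𝓝 (g z k)) :=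
    (hcomp hg z hz).mono_left (nhdsWithin_mono z interior_subset)
  have t2 : Tendsto (fun x => g' x k) (𝓝[interior (body K')] z) (𝓝 (g' z k)) :=
    (hcomp hg' z hz').mono_left (nhdsWithin_mono z interior_subset)
  have t3 : ∀ D : Set (Vec d), Tendsto (fun x => ‖x - z‖) (𝓝[D] z) (𝓝 0) := fun D => by
    have : Continuous fun x : Vec d => ‖x - z‖ := by fun_prop
    simpa using (this.tendsto z).mono_left nhdsWithin_le_nhds
  have t4 : Tendsto (fun w : Vec d × Vec d => |g' w.2 k - g w.1 k|)
      (𝓝[interior (body K)] z ×ˢ 𝓝[interior (body K')] z) (𝓝 |g' z k - g z k|) :=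
    ((t2.comp tendsto_snd).sub (t1.comp tendsto_fst)).abs
  have t5 : Tendsto (fun w : Vec d × Vec d => M * (L * (‖w.1 - z‖ + ‖w.2 - z‖)))
      (𝓝[interior (body K)] z ×ˢ 𝓝[interior (body K')] z) (𝓝 0) := by
    simpa using ((((t3 _).comp tendsto_fst).add ((t3 _).comp tendsto_snd)).const_mul L).const_mul M
  have hball : ∀ D : Set (Vec d), ∀ᶠ x in 𝓝[D] z, x ∈ D ∩ Metric.ball z r := fun D =>
    inter_mem self_mem_nhdsWithin (mem_nhdsWithin_of_mem_nhds (Metric.ball_mem_nhds z hr))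
  have hle : |g' z k - g z k| ≤ 0 := by
    refine le_of_tendsto_of_tendsto t4 t5 ?_
    filter_upwards [(hball (interior (body K))).prod_mk (hball (interior (body K')))] with w hw
    exact key w.1 hw.1 w.2 hw.2
  exact (sub_eq_zero.1 (abs_nonpos_iff.1 hle)).symm

/-! ### The linear Lagrange interpolant -/

theorem exists_affine_interpolant {d m : ℕ} {T : Mesh d} {K : Finset (Vec d)}
    (hK : K ∈ elements T) (val : Vec d → Vec m) :
    ∃ A : Vec d →ᵃ[ℝ] Vec m, ∀ z ∈ K, A z = val z := by
  let b : AffineBasis K ℝ (Vec d) := ⟨(↑), T.indep hK.1, by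
    have := (affineSpan_eq_top_iff_card (T.indep hK.1)).2 hK.2
    simpa using this⟩
  refine ⟨∑ i : K, (LinearMap.toSpanSingleton ℝ (Vec m) (val i)).toAffineMap.comp (b.coord i),
    fun z hz => ?_⟩
  have hcoord : ∀ i : K, b.coord i z = if i = ⟨z, hz⟩ then 1 else 0 := fun i =>
    b.coord_apply i ⟨z, hz⟩
  have happ : ∀ (s : Finset K) (F : K → Vec d →ᵃ[ℝ] Vec m), (∑ i ∈ s, F i) z = ∑ i ∈ s, F i z := by
    classical
    intro s F
    induction s using Finset.induction_on with
    | empty => simp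
    | insert a s ha ih => rw [Finset.sum_insert ha, Finset.sum_insert ha, ← ih]; rfl
  rw [happ]
  simp [hcoord]

theorem convex_eqLocus {d m : ℕ} (A B : Vec d →ᵃ[ℝ] Vec m) : Convex ℝ {x | A x = B x} := by
  intro x hx y hy a b _ _ hab
  simp only [mem_ofPred_eq] at *
  rw [Convex.combo_affine_apply hab, Convex.combo_affine_apply hab, hx, hy]

theorem IsTriangulation.exists_isLagrange {d m : ℕ} {Ω : Set (Vec d)} {T : Mesh d}
    (hT : IsTriangulation Ω T) (val : Vec d → Vec m) :
    ∃ w, IsLagrange T w ∧ ∀ z ∈ T.vertices, w z = val z := by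
  classical
  have hA := fun K : elements T => exists_affine_interpolant K.2 val
  choose A hA using hA
  have hagree : ∀ (K K' : elements T), ∀ x ∈ body K.1, x ∈ body K'.1 → A K x = A K' x := by
    intro K K' x hx hx'
    have h1 := T.inter_subset_convexHull K.2.1 K'.2.1 ⟨hx, hx'⟩
    refine convexHull_min (fun z hz => ?_) (convex_eqLocus (A K) (A K')) h1
    exact (hA K z hz.1).trans (hA K' z hz.2).symm
  have hex : ∀ x : Vec d, x ∈ T.space → ∃ K : elements T, x ∈ body K.1 := fun x hx => by
    obtain ⟨K, hK, hxK⟩ := hT.exists_mem_body hx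
    exact ⟨⟨K, hK⟩, hxK⟩
  set w : Vec d → Vec m := fun x => if h : x ∈ T.space then A (hex x h).choose x else 0 with hw
  have hwK : ∀ (K : elements T), ∀ x ∈ body K.1, w x = A K x := fun K x hx => by
    have hxs : x ∈ T.space := T.convexHull_subset_space K.2.1 hx
    simp only [hw, hxs, dif_pos]
    exact hagree _ K x (hex x hxs).choose_spec hx
  have hspace : T.space = ⋃ K : elements T, body K.1 := by
    ext x
    rw [mem_iUnion]
    exact ⟨hex x, fun ⟨K, hx⟩ => T.convexHull_subset_space K.2.1 hx⟩
  refine ⟨w, ⟨?_, fun K hK => ⟨A ⟨K, hK⟩, hwK ⟨K, hK⟩⟩⟩, fun z hz => ?_⟩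
  · rw [hspace]
    have := hT.finite_elements.to_subtype
    refine (locallyFinite_of_finite _).continuousOn_iUnion
      (fun K => (isCompact_body K.1).isClosed) fun K => ?_
    exact ((A K).continuous_of_finiteDimensional.continuousOn).congr (hwK K)
  · obtain ⟨K, hK, hzK⟩ := hT.pure {z} hz
    have hz' : z ∈ K := hzK (Finset.mem_singleton_self z)
    rw [hwK ⟨K, hK⟩ z (subset_convexHull ℝ _ hz'), hA ⟨K, hK⟩ z hz']

/-! ### The interpolation error -/

theorem convexOn_body_of_interior {d : ℕ} {K : Finset (Vec d)} (hne : (interior (body K)).Nonempty)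
    {q : Vec d → ℝ} (hq : ContinuousOn q (body K)) (h : ConvexOn ℝ (interior (body K)) q) :
    ConvexOn ℝ (body K) q := by
  have hconv : Convex ℝ (body K) := convex_convexHull ℝ _
  obtain ⟨p, hp⟩ := hne
  refine ⟨hconv, fun x hx y hy a b ha hb hab => ?_⟩
  have hmem : ∀ v ∈ body K, ∀ t ∈ Ioo (0 : ℝ) 1, (1 - t) • v + t • p ∈ interior (body K) :=
    fun v hv t ht => hconv.combo_self_interior_mem_interior hv hp (by linarith [ht.2]) ht.1
      (by ring)
  have hlim : ∀ v ∈ body K, Tendsto (fun t : ℝ => q ((1 - t) • v + t • p)) (𝓝[>] 0) (𝓝 (q v)) := by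
    intro v hv
    have h1 : Tendsto (fun t : ℝ => (1 - t) • v + t • p) (𝓝[>] 0) (𝓝[body K] v) := by
      refine tendsto_nhdsWithin_iff.2 ⟨?_, ?_⟩
      · have : Continuous fun t : ℝ => (1 - t) • v + t • p := by fun_prop
        simpa using (this.tendsto 0).mono_left nhdsWithin_le_nhds
      · filter_upwards [Ioo_mem_nhdsGT (zero_lt_one' ℝ)] with t ht
        exact interior_subset (hmem v hv t ht)
    exact (hq v hv).tendsto.comp h1
  refine le_of_tendsto_of_tendsto (hlim _ (hconv hx hy ha hb hab))
    (((hlim x hx).const_smul a).add ((hlim y hy).const_smul b)) ?_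
  filter_upwards [Ioo_mem_nhdsGT (zero_lt_one' ℝ)] with t ht
  have h1 := h.2 (hmem x hx t ht) (hmem y hy t ht) ha hb hab
  have e : a • ((1 - t) • x + t • p) + b • ((1 - t) • y + t • p) =
      (1 - t) • (a • x + b • y) + t • p := by
    rw [show b = 1 - a by linarith]
    module
  rwa [e] at h1

theorem sum_mul_norm_sq_sub {d : ℕ} {K : Finset (Vec d)} {l : Vec d → ℝ} (hl : ∑ z ∈ K, l z = 1)
    {x : Vec d} (hx : ∑ z ∈ K, l z • z = x) :
    ∑ z ∈ K, l z * ‖z‖ ^ 2 - ‖x‖ ^ 2 = ∑ z ∈ K, l z * ‖z - x‖ ^ 2 := by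
  have h1 : ∀ z, l z * ‖z - x‖ ^ 2 = l z * ‖z‖ ^ 2 - 2 * inner ℝ (l z • z) x + l z * ‖x‖ ^ 2 :=
    fun z => by
      rw [norm_sub_sq_real, real_inner_smul_left]
      ring
  simp only [h1]
  rw [Finset.sum_add_distrib, Finset.sum_sub_distrib, ← Finset.mul_sum, ← sum_inner, hx,
    ← Finset.sum_mul, hl, real_inner_self_eq_norm_sq]
  ring

/-- The upper half of the error estimate for linear interpolation. -/
theorem le_interpolation_add {d : ℕ} {K : Finset (Vec d)} (hne : (interior (body K)).Nonempty)
    {g : Vec d → ℝ} (hg : ContinuousOn g (body K)) {H : ℝ} (hH : 0 ≤ H)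
    (hb : HessBound (interior (body K)) ((interior (body K)).indicator g) H)
    {l : Vec d → ℝ} (hl0 : ∀ z ∈ K, 0 ≤ l z) (hl : ∑ z ∈ K, l z = 1) {x : Vec d}
    (hx : ∑ z ∈ K, l z • z = x) :
    g x ≤ ∑ z ∈ K, l z * g z + H / 2 * Metric.diam (body K) ^ 2 := by
  set D := interior (body K) with hD
  have hint : Integrable (D.indicator g) := by
    rw [integrable_indicator_iff measurableSet_interior]
    exact (hg.integrableOn_compact (isCompact_body K)).mono_set interior_subset
  have hc1 : ConvexOn ℝ D fun x => D.indicator g x + H / 2 * ‖x‖ ^ 2 :=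
    convexOn_add_sq isOpen_interior (convex_convexHull ℝ _).interior hint
      ((hg.mono interior_subset).congr fun y hy => indicator_of_mem hy g) hb
  have hc2 : ConvexOn ℝ D fun x => g x + H / 2 * ‖x‖ ^ 2 :=
    hc1.congr fun y hy => by simp only [indicator_of_mem hy g]
  have hc3 : ConvexOn ℝ (body K) fun x => g x + H / 2 * ‖x‖ ^ 2 :=
    convexOn_body_of_interior hne (hg.add (by fun_prop)) hc2
  have hmem : ∀ z ∈ K, z ∈ body K := fun z hz => subset_convexHull ℝ _ hz
  have h1 := hc3.map_sum_le hl0 hl hmem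
  simp only [hx, smul_eq_mul, mul_add, Finset.sum_add_distrib] at h1
  have hxK : x ∈ body K := by
    rw [← hx]
    exact (convex_convexHull ℝ _).sum_mem hl0 hl hmem
  have h2 : ∑ z ∈ K, l z * ‖z - x‖ ^ 2 ≤ Metric.diam (body K) ^ 2 := by
    calc ∑ z ∈ K, l z * ‖z - x‖ ^ 2 ≤ ∑ z ∈ K, l z * Metric.diam (body K) ^ 2 := by
          refine Finset.sum_le_sum fun z hz => mul_le_mul_of_nonneg_left ?_ (hl0 z hz)
          rw [← dist_eq_norm]
          have := Metric.dist_le_diam_of_mem (isCompact_body K).isBounded (hmem z hz) hxK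
          gcongr
      _ = Metric.diam (body K) ^ 2 := by rw [← Finset.sum_mul, hl, one_mul]
  rw [← sum_mul_norm_sq_sub hl hx] at h2
  have h3 : ∑ z ∈ K, l z * (H / 2 * ‖z‖ ^ 2) = H / 2 * ∑ z ∈ K, l z * ‖z‖ ^ 2 := by
    rw [Finset.mul_sum]
    exact Finset.sum_congr rfl fun z _ => by ring
  rw [h3] at h1
  nlinarith

theorem abs_sub_interpolation_le {d : ℕ} {K : Finset (Vec d)} (hne : (interior (body K)).Nonempty)
    {g : Vec d → ℝ} (hg : ContinuousOn g (body K)) {H : ℝ} (hH : 0 ≤ H)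
    (hb : HessBound (interior (body K)) ((interior (body K)).indicator g) H)
    {l : Vec d → ℝ} (hl0 : ∀ z ∈ K, 0 ≤ l z) (hl : ∑ z ∈ K, l z = 1) {x : Vec d}
    (hx : ∑ z ∈ K, l z • z = x) :
    |g x - ∑ z ∈ K, l z * g z| ≤ H / 2 * Metric.diam (body K) ^ 2 := by
  have h1 := le_interpolation_add hne hg hH hb hl0 hl hx
  have hb' : HessBound (interior (body K)) ((interior (body K)).indicator fun x => - g x) H := by
    have e : (interior (body K)).indicator (fun x => - g x) =
        fun x => - (interior (body K)).indicator g x := indicator_neg _ _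
    rw [e]
    exact hb.neg
  have h2 := le_interpolation_add hne hg.neg hH hb' hl0 hl hx
  simp only [Pi.neg_apply, mul_neg, Finset.sum_neg_distrib] at h2
  exact abs_le.2 ⟨by linarith, by linarith⟩

theorem diam_body_le_meshSize {d : ℕ} {Ω : Set (Vec d)} {T : Mesh d} (hT : IsTriangulation Ω T)
    {K : Finset (Vec d)} (hK : K ∈ elements T) : Metric.diam (body K) ≤ meshSize T :=
  le_csSup (hT.finite_elements.image _).bddAbove (mem_image_of_mem _ hK)

theorem nodalAverage_eq {d : ℕ} {Ω : Set (Vec d)} {T : Mesh d} (hT : IsTriangulation Ω T)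
    {u : Vec d → Vec d} {z : Vec d} {K : Finset (Vec d)} (hK : K ∈ patch T z)
    (h : ∀ K' ∈ patch T z, elementCurl K' u z = elementCurl K u z) :
    nodalAverage T u z = elementCurl K u z := by
  have hfin : (patch T z).Finite := hT.finite_elements.subset fun _ hK => hK.1
  rw [nodalAverage, finsum_mem_congr rfl h, finsum_mem_eq_finite_toFinset_sum _ hfin,
    Finset.sum_const, ncard_eq_toFinset_card _ hfin, ← Nat.cast_smul_eq_nsmul ℝ, smul_smul,
    inv_mul_cancel₀, one_smul]
  have : hfin.toFinset.Nonempty := ⟨K, hfin.mem_toFinset.2 hK⟩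
  exact_mod_cast this.card_pos.ne'

theorem norm_le_sum_abs {m : ℕ} (v : Vec m) : ‖v‖ ≤ ∑ k, |v k| := by
  conv_lhs => rw [basisVec_sum v]
  refine (norm_sum_le _ _).trans_eq (Finset.sum_congr rfl fun k _ => ?_)
  rw [norm_smul]
  simp [basisVec]

theorem affineMap_sum {d m : ℕ} (A : Vec d →ᵃ[ℝ] Vec m) {K : Finset (Vec d)} {l : Vec d → ℝ}
    (hl : ∑ z ∈ K, l z = 1) : A (∑ z ∈ K, l z • z) = ∑ z ∈ K, l z • A z := by
  obtain ⟨a, h⟩ : ∃ a, ∀ x, A x = A.linear x + a := ⟨A 0, fun x => congrFun A.decomp x⟩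
  simp only [h, map_sum, map_smul, smul_add, Finset.sum_add_distrib, ← Finset.sum_smul, hl,
    one_smul]

/-! ### The recovered curl -/

theorem IsHZeroCurl.isRecoverable {d : ℕ} {Ω : Set (Vec d)} (hΩ : IsLipschitzDomain Ω)
    {T : Mesh d} (hT : IsTriangulation Ω T) {u : Vec d → Vec d} {c : Vec d → Vec (curlDim d)}
    (h : IsHZeroCurl Ω u c) (hpw : MemPW Ω T u) : IsRecoverable T u := fun _ hK =>
  exists_isElementCurl ENNReal.toReal_nonneg (weakDerivBound_pwNorm hT.finite hpw hK)
    (h.isWeakCurl hΩ.isOpen hΩ.isBounded (hT.interior_body_subset hΩ hK))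
    ((integrableOn_of_memLp_two hΩ.isBounded h.memLp_curl).mono_set
      (hT.interior_body_subset hΩ hK))

theorem IsHZeroCurl.ae_elementCurl_eq {d : ℕ} {Ω : Set (Vec d)} (hΩ : IsLipschitzDomain Ω)
    {T : Mesh d} (hT : IsTriangulation Ω T) {u : Vec d → Vec d} {c : Vec d → Vec (curlDim d)}
    (h : IsHZeroCurl Ω u c) (hrec : IsRecoverable T u) {K : Finset (Vec d)}
    (hK : K ∈ elements T) : ∀ᵐ x, x ∈ interior (body K) → elementCurl K u x = c x :=
  (isElementCurl_elementCurl (hrec K hK)).2.ae_eq isOpen_interior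
    (h.isWeakCurl hΩ.isOpen hΩ.isBounded (hT.interior_body_subset hΩ hK))

/-- At a node, the average of the elementwise curls is each one of them. -/
theorem IsSourceSolution.nodalAverage_eq_elementCurl {d : ℕ} (hd : d = 2 ∨ d = 3)
    {Ω : Set (Vec d)} (hΩ : IsLipschitzDomain Ω) {T : Mesh d} (hT : IsTriangulation Ω T)
    {f u : Vec d → Vec d} {c : Vec d → Vec (curlDim d)} {s : Vec d → ℝ} {gs : Vec d → Vec d}
    (h : IsSourceSolution Ω f u c s gs) (hf : MemLp f 2 (volume.restrict Ω)) (hpw : MemPW Ω T u)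
    {K : Finset (Vec d)} (hK : K ∈ elements T) {z : Vec d} (hz : z ∈ K) :
    nodalAverage T u z = elementCurl K u z := by
  have hrec := h.mem_u.isRecoverable hΩ hT hpw
  refine nodalAverage_eq hT ⟨hK, hz⟩ fun K' hK' => ?_
  ext k
  exact eq_of_gradBound hΩ hT (by positivity)
    (integrable_extComp hΩ.isOpen.measurableSet
      (integrableOn_of_memLp_two hΩ.isBounded h.mem_u.memLp_curl) k)
    (h.gradBound hd hΩ hT hf hpw k) hK'.1 hK
    (isElementCurl_elementCurl (hrec K' hK'.1)).1 (isElementCurl_elementCurl (hrec K hK)).1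
    (h.mem_u.ae_elementCurl_eq hΩ hT hrec hK'.1) (h.mem_u.ae_elementCurl_eq hΩ hT hrec hK)
    (subset_convexHull ℝ _ hK'.2) (subset_convexHull ℝ _ hz)

/-- The pointwise error of the recovered curl on an element. -/
theorem IsSourceSolution.norm_elementCurl_sub_le {d : ℕ} (hd : d = 2 ∨ d = 3)
    {Ω : Set (Vec d)} (hΩ : IsLipschitzDomain Ω) {T : Mesh d} (hT : IsTriangulation Ω T)
    {f u : Vec d → Vec d} {c : Vec d → Vec (curlDim d)} {s : Vec d → ℝ} {gs : Vec d → Vec d}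
    (h : IsSourceSolution Ω f u c s gs) (hf : MemLp f 2 (volume.restrict Ω)) (hpw : MemPW Ω T u)
    {w : Vec d → Vec (curlDim d)} (hw : IsCurlRecovery T u w)
    {K : Finset (Vec d)} (hK : K ∈ elements T) {x : Vec d} (hx : x ∈ body K) :
    ‖elementCurl K u x - w x‖ ≤
      curlDim d * (d * (d * (pwNorm T u).toReal) * meshSize T ^ 2) := by
  have hE := isElementCurl_elementCurl (hw.recoverable K hK)
  obtain ⟨A, hA⟩ := hw.lagrange.2 K hK
  obtain ⟨l, hl0, hl, hlx⟩ := Finset.mem_convexHull'.1 hx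
  have hvert : ∀ z ∈ K, A z = elementCurl K u z := fun z hz => by
    rw [← hA z (subset_convexHull ℝ _ hz), hw.nodal z
      (T.down_closed hK.1 (Finset.singleton_subset_iff.2 hz) (Finset.singleton_nonempty z)),
      h.nodalAverage_eq_elementCurl hd hΩ hT hf hpw hK hz]
  have hwx : w x = ∑ z ∈ K, l z • elementCurl K u z := by
    rw [hA x hx, ← hlx, affineMap_sum A hl]
    exact Finset.sum_congr rfl fun z hz => by rw [hvert z hz]
  have hcomp : ∀ k, |(elementCurl K u x - w x) k| ≤
      d * (d * (pwNorm T u).toReal) * meshSize T ^ 2 := fun k => by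
    have hcont : ContinuousOn (fun y => elementCurl K u y k) (body K) :=
      (EuclideanSpace.proj (𝕜 := ℝ) k : Vec (curlDim d) →L[ℝ] ℝ).continuous.comp_continuousOn hE.1
    have h1 := abs_sub_interpolation_le (interior_body_nonempty hK) hcont
      (H := d * (d * (2 * (pwNorm T u).toReal))) (by positivity)
      (hE.2.hessBound measurableSet_interior (weakDerivBound_pwNorm hT.finite hpw hK)
        (integrableOn_elementCurl hE) k) hl0 hl hlx
    have e : (elementCurl K u x - w x) k =
        elementCurl K u x k - ∑ z ∈ K, l z * elementCurl K u z k := by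
      rw [hwx]
      simp
    rw [e]
    refine h1.trans ?_
    have h2 : Metric.diam (body K) ^ 2 ≤ meshSize T ^ 2 :=
      pow_le_pow_left₀ Metric.diam_nonneg (diam_body_le_meshSize hT hK) 2
    calc _ = d * (d * (pwNorm T u).toReal) * Metric.diam (body K) ^ 2 := by ring
      _ ≤ _ := by gcongr
  refine (norm_le_sum_abs _).trans ((Finset.sum_le_sum fun k _ => hcomp k).trans_eq ?_)
  simp

end

end CurlRecovery

theorem theorem4p1 (d : ℕ) (hd : d = 2 ∨ d = 3) (Ω : Set (Vec d)) (hΩ : IsLipschitzDomain Ω)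
    (hsc : SimplyConnectedSpace Ω) (σ : ℝ) :
    ∃ C : ℝ, 0 < C ∧
      ∀ T : Mesh d, IsTriangulation Ω T → IsQuasiUniform σ T →
      ∀ (f u : Vec d → Vec d) (curlu : Vec d → Vec (curlDim d)) (s : Vec d → ℝ)
        (grads : Vec d → Vec d),
        MemLp f 2 (volume.restrict Ω) →
        IsSourceSolution Ω f u curlu s grads →
        MemPW Ω T u →
        (∃ w, IsCurlRecovery T u w) ∧
        ∀ w, IsCurlRecovery T u w →
          eLpNorm (fun x => curlu x - w x) 2 (volume.restrict Ω) ≤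
            ENNReal.ofReal (C * meshSize T ^ 2) * pwNorm T u := by
  have hfin : volume Ω ^ (2 : ℝ)⁻¹ ≠ ⊤ :=
    ENNReal.rpow_ne_top_of_nonneg (by norm_num) hΩ.isBounded.measure_lt_top.ne
  set V : ℝ := (volume Ω ^ (2 : ℝ)⁻¹).toReal with hV
  have hV0 : 0 ≤ V := ENNReal.toReal_nonneg
  refine ⟨V * (curlDim d * (d * d)) + 1, by positivity, ?_⟩
  intro T hT _ f u curlu s grads hf hsol hpw
  have hrec := hsol.mem_u.isRecoverable hΩ hT hpw
  refine ⟨?_, fun w hw => ?_⟩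
  · obtain ⟨w, hw, hnode⟩ := hT.exists_isLagrange (nodalAverage T u)
    exact ⟨w, hrec, hw, hnode⟩
  set M : ℝ := (pwNorm T u).toReal with hM
  have hM0 : 0 ≤ M := ENNReal.toReal_nonneg
  have hae : ∀ᵐ x ∂(volume.restrict Ω),
      ‖curlu x - w x‖ ≤ curlDim d * (d * (d * M) * meshSize T ^ 2) := by
    rw [ae_restrict_iff' hΩ.isOpen.measurableSet]
    have h1 : ∀ᵐ x, ∀ K ∈ elements T, x ∈ interior (body K) → elementCurl K u x = curlu x :=
      (ae_ball_iff hT.finite_elements.countable).2 fun K hK =>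
        hsol.mem_u.ae_elementCurl_eq hΩ hT hrec hK
    have h2 : ∀ᵐ x, x ∉ skeleton T := measure_eq_zero_iff_ae_notMem.1 hT.volume_skeleton
    filter_upwards [h1, h2] with x hx hxs hxΩ
    obtain ⟨K, hK, hxK⟩ := hT.exists_mem_interior hxΩ hxs
    rw [← hx K hK hxK]
    exact hsol.norm_elementCurl_sub_le hd hΩ hT hf hpw hw hK (interior_subset hxK)
  refine (eLpNorm_le_of_ae_bound hae).trans ?_
  have e1 : pwNorm T u = ENNReal.ofReal M :=
    (ENNReal.ofReal_toReal (pwNorm_ne_top hT.finite hpw)).symm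
  have e2 : (volume.restrict Ω) univ ^ (2 : ℝ≥0∞).toReal⁻¹ = ENNReal.ofReal V := by
    rw [hV, ENNReal.ofReal_toReal hfin, Measure.restrict_apply_univ]
    simp
  rw [e1, e2, ← ENNReal.ofReal_mul hV0, ← ENNReal.ofReal_mul (by positivity)]
  refine ENNReal.ofReal_le_ofReal ?_
  have h3 : 0 ≤ meshSize T ^ 2 * M := by positivity
  nlinarith
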